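/- **Setting.** Let $G=(V,E)$ be a finite graph with positive conductances $(W_{i,j})_{\{i,j\}\in E}$, $W_{i,j}=W_{j,i}$, and let $i_0\in V$. The mixing field of the vertex reinforced jump process (VRJP) rooted at $i_0$ is the measure on $\{u\in\mathbb R^V: u_{i_0}=0\}$ given by $$\mathbb Q_{i_0}^W(du)=\frac{1}{\sqrt{2\pi}^{\,|V|-1}}\,\exp\Big(-\tfrac12\sum_{i\to j}W_{i,j}(e^{u_j-u_i}-1)\Big)\sqrt{D_{i_0}(W,u)}\prod_{i\neq i_0}du_i,\qquad D_{i_0}(W,u)=\sum_{T}\prod_{(i,j)\in T}W_{i,j}e^{u_j-u_i},$$ where $\sum_{i\to j}$ runs over the directed edges (both orientations of each edge) and $T$ over the directed spanning trees oriented towards the root $i_0$. Consider the nearest neighbour lattice $\mathbb Z^2$ with positive conductances $(W_{i,j})_{i\sim j}$. For $N\in\mathbb N$ let $V_N=\mathbb Z^2\cap[-N,N]^2$, and let $\mathcal G_N$ be the graph on $V_N\cup\{\delta_N\}$ obtained by contracting all the vertices of $\mathbb Z^2\setminus V_N$ to the single point $\delta_N$ (wired boundary condition), removing loops and identifying multiple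 edges; the conductance of an edge of $\mathcal G_N$ is the sum of the conductances of the edges of $\mathbb Z^2$ mapped to it. Let $\mathbb Q^N$ be the mixing field of $\mathcal G_N$ with these conductances, rooted at $i_0=0$. Write $|y|_1=|y_1|+|y_2|$. **Theorem 1.** There are absolute constants $c_0>0$ and $N_0\in\mathbb N$ such that the following holds. Let $0<\overline W<\infty$ and $0<s<1$, let $q>1$ be given by $s+\frac1q=1$, and put $$\eta=\eta(\overline W,s)=\frac{c_0s^2}{8q^2(\overline W+1)}>0.$$ Then for all positive conductances on $\mathbb Z^2$ with $W_{i,j}\le\overline W$ for all $i\sim j$, all $N\ge N_0$ and all $y\in V_N$ with $y\ne0$, the function $e^{su_y}$ is $\mathbb Q^N$-integrable and $$\mathbb E^{\mathbb Q^N}(e^{su_y})\le|y|_1^{-\eta}$$ (hence the same bound holds with the Euclidean or the sup norm of $y$). Moreover the constant $c_0$ in the exponent can be taken arbitrarily close to $1/8$ for large $|y|_1$: for every $0<c<1/8$ there is $r=r(c)$ such that, for all $\overline W, s, q$, all such conductances, all $N\ge N_0$ and all $y\in V_N\setminus\{0\}$ with $|y|_1\ge r$, $$\mathbb E^{\mathbb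 Q^N}(e^{su_y})\le|y|_1^{-c s^2/(8q^2(\overline W+1))}.$$ -/

import Mathlib

/-! ### The mixing field of the VRJP on a finite graph -/

/-- `T` (a set of directed edges of `G`) is a directed spanning tree oriented towards the root `i₀`:
every vertex other than the root has exactly one outgoing edge, the root has none, and from every
vertex one reaches the root by following the edges of `T`. -/
def IsSpanningTreeTowards {V : Type*} (G : SimpleGraph V) (i₀ : V) (T : Finset (V × V)) : Prop :=
  (∀ e ∈ T, G.Adj e.1 e.2) ∧
  (∀ i, i ≠ i₀ → ∃! j, (i, j) ∈ T) ∧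
  (∀ j, (i₀, j) ∉ T) ∧
  (∀ i, Relation.ReflTransGen (fun a b => (a, b) ∈ T) i i₀)

open Classical in
/-- `D_{i₀}(W, u) = ∑_T ∏_{(i,j) ∈ T} W_{i,j} e^{u_j - u_i}`, the sum running over the directed
spanning trees oriented towards `i₀`. Conductances are functions of the unoriented edge. -/
noncomputable def treeSum {V : Type*} [Fintype V] (G : SimpleGraph V) (W : Sym2 V → ℝ) (i₀ : V)
    (u : V → ℝ) : ℝ :=
  ∑ T : Finset (V × V) with IsSpanningTreeTowards G i₀ T,
    ∏ e ∈ T, W s(e.1, e.2) * Real.exp (u e.2 - u e.1)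

open Classical in
/-- `∑_{i → j} W_{i,j} (e^{u_j - u_i} - 1)`, the sum running over directed edges, so that each
unoriented edge contributes twice. -/
noncomputable def edgeEnergy {V : Type*} [Fintype V] (G : SimpleGraph V) (W : Sym2 V → ℝ)
    (u : V → ℝ) : ℝ :=
  ∑ i : V, ∑ j : V, if G.Adj i j then W s(i, j) * (Real.exp (u j - u i) - 1) else 0

/-- The density of the mixing field with respect to `∏_{i ≠ i₀} du_i`. -/
noncomputable def mixingDensity {V : Type*} [Fintype V] (G : SimpleGraph V) (W : Sym2 V → ℝ)
    (i₀ : V) (u : V → ℝ) : ℝ :=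
  1 / Real.sqrt (2 * Real.pi) ^ (Fintype.card V - 1) *
    Real.exp (-(1 / 2) * edgeEnergy G W u) * Real.sqrt (treeSum G W i₀ u)

/-- The field `u` on `V` with `u i₀ = 0` and the prescribed values at the other vertices. -/
def extendByZero {V : Type*} [DecidableEq V] (i₀ : V) (x : {i : V // i ≠ i₀} → ℝ) : V → ℝ :=
  fun i => if h : i = i₀ then 0 else x ⟨i, h⟩

/-- The mixing field `ℚ_{i₀}^W(du)`: the measure with density `mixingDensity` with respect to
Lebesgue measure `∏_{i ≠ i₀} du_i` on `{u : V → ℝ | u i₀ = 0}`. -/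
noncomputable def mixingField {V : Type*} [Fintype V] [DecidableEq V] (G : SimpleGraph V)
    (W : Sym2 V → ℝ) (i₀ : V) : MeasureTheory.Measure (V → ℝ) :=
  ((MeasureTheory.volume : MeasureTheory.Measure ({i : V // i ≠ i₀} → ℝ)).withDensity
    (fun x => ENNReal.ofReal (mixingDensity G W i₀ (extendByZero i₀ x)))).map (extendByZero i₀)

/-! ### The lattice `ℤ²` and its boxes with wired boundary condition -/

/-- The norm `|x|₁` on `ℤ²`. -/
def l1Norm (x : ℤ × ℤ) : ℤ := |x.1| + |x.2|

/-- The usual nearest neighbour graph on `ℤ²`. -/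
def lattice : SimpleGraph (ℤ × ℤ) where
  Adj i j := l1Norm (i - j) = 1
  symm := ⟨fun i j h => by
    have h2 : l1Norm (j - i) = l1Norm (i - j) := by
      simp only [l1Norm, Prod.fst_sub, Prod.snd_sub, abs_sub_comm]
    exact h2.trans h⟩
  loopless := ⟨fun i h => by simp [l1Norm] at h⟩

/-- `V_N = ℤ² ∩ [-N, N]²`. -/
noncomputable def box (N : ℕ) : Finset (ℤ × ℤ) :=
  Finset.Icc (-(N : ℤ)) (N : ℤ) ×ˢ Finset.Icc (-(N : ℤ)) (N : ℤ)

/-- `V_N ∪ {δ_N}`, with `δ_N = none`. -/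
abbrev WiredVertex (N : ℕ) : Type := Option {x : ℤ × ℤ // x ∈ box N}

/-- The contraction of all the vertices outside `V_N` to the single point `δ_N`. -/
noncomputable def contract (N : ℕ) (x : ℤ × ℤ) : WiredVertex N :=
  if h : x ∈ box N then some ⟨x, h⟩ else none

/-- The wired graph `𝒢_N`: its edges are the images of the lattice edges under the contraction,
with loops removed and multiple edges identified. -/
def wiredGraph (N : ℕ) : SimpleGraph (WiredVertex N) where
  Adj a b := a ≠ b ∧ ∃ f ∈ lattice.edgeSet, f.map (contract N) = s(a, b)
  symm := ⟨fun a b h => ⟨h.1.symm, by rw [Sym2.eq_swap]; exact h.2⟩⟩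
  loopless := ⟨fun _ h => h.1 rfl⟩

/-- The conductance of an edge of `𝒢_N`: the sum of the conductances of the lattice edges mapped
to it by the contraction. (Only finitely many lattice edges are mapped to an edge of `𝒢_N`.) -/
noncomputable def wiredConductance (N : ℕ) (W : Sym2 (ℤ × ℤ) → ℝ) (e : Sym2 (WiredVertex N)) : ℝ :=
  ∑ᶠ f ∈ {f : Sym2 (ℤ × ℤ) | f ∈ lattice.edgeSet ∧ f.map (contract N) = e}, W f

/-- `ℚ^N`, the mixing field on `𝒢_N` rooted at the origin. -/
noncomputable def wiredField (N : ℕ) (W : Sym2 (ℤ × ℤ) → ℝ) :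
    MeasureTheory.Measure (WiredVertex N → ℝ) :=
  mixingField (wiredGraph N) (wiredConductance N W) (contract N 0)

/-! The moment is bounded by deforming the field, in the spirit of Mermin and Wagner. Put `t = 1/q =
1 - s` and let `v` vanish at the root. The fields `u + v` and `u - (s/t) v` have barycentre `u` for
the weights `s`, `t`, so the density at `u` is compared with the product of the densities at these
two fields, raised to the powers `s` and `t`. The tree sum is log-convex in `u`, which is the
favourable direction (`treeSum_convexComb_le`). The energy is convex as well, which is unfavourable,
but the defect is of second order in the gradient of `v`. It is absorbed by lowering the
conductances of the second density by a relative amount `r` quadratic in that gradient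
(`edgeEnergy_deformation_le`). Hölder's inequality with exponents `1/s` and `1/t` then gives `E e^{s
u_y} ≤ exp (-s v_y + t * cost)` (`lintegral_exp_mul_le`), provided that, for all positive
conductances, the mixing field has mass at most one and `E e^{u_y} ≤ 1`.

For these two a priori bounds the field is replaced by the diagonal of the operator `H` with
off-diagonal entries `-W_{i,j}` and `H e^u = η`, where `η` is the vector of conductances to the
root. The Jacobian is `det H`, which dominates the tree sum by the matrix-tree expansion, and the
density becomes `exp (-(⟨1, H 1⟩ + ⟨η, H⁻¹ η⟩) / 2) / √(det H)`. Vertices are integrated out one by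
one: the Schur complement of the last vertex has an inverse Gaussian type density, whose mass is
explicit, and the remaining density has the same form with a new `η`. Since `e^{u_y} = (H⁻¹ η)_y`,
taking `y` as the last vertex bounds the first moment by the same constant. Upper bounds suffice
throughout.

In dimension two, `v` is a truncated logarithm of the sup norm. With height `κ h`, where `h ≥ (log
|y|₁) / 2`, its Dirichlet energy is at most `8 κ² h` over directed edges. The gain is linear in `κ`
and the cost quadratic, so a fixed small `κ` leaves a negative multiple of `log |y|₁`. -/

/-! ### One-dimensional Gaussian and inverse Gaussian integrals -/

open MeasureTheory Set in
theorem lintegral_gaussian_half :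
    ∫⁻ y : ℝ, ENNReal.ofReal (Real.exp (-y ^ 2 / 2)) = ENNReal.ofReal √(2 * Real.pi) := by
  have h := integral_gaussian (1 / 2)
  have e : ∀ y : ℝ, -(1 / 2 : ℝ) * y ^ 2 = -y ^ 2 / 2 := fun y => by ring
  simp only [e] at h
  rw [← ofReal_integral_eq_lintegral_ofReal]
  · rw [h]; congr 2; ring
  · have := integrable_exp_neg_mul_sq (b := 1 / 2) (by norm_num)
    simpa only [e] using this
  · exact Filter.Eventually.of_forall fun y => (Real.exp_pos _).le

open MeasureTheory Set in
theorem lintegral_gaussian_half_Ioi :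
    ∫⁻ y in Ioi (0 : ℝ), ENNReal.ofReal (Real.exp (-y ^ 2 / 2)) =
      ENNReal.ofReal (√(2 * Real.pi) / 2) := by
  have h := integral_gaussian_Ioi (1 / 2)
  have e : ∀ y : ℝ, -(1 / 2 : ℝ) * y ^ 2 = -y ^ 2 / 2 := fun y => by ring
  simp only [e] at h
  rw [← ofReal_integral_eq_lintegral_ofReal]
  · rw [h]; congr 3; ring
  · have := integrable_exp_neg_mul_sq (b := 1 / 2) (by norm_num)
    simp only [e] at this
    exact this.integrableOn
  · exact Filter.Eventually.of_forall fun y => (Real.exp_pos _).le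

/-- The unnormalised inverse Gaussian type density. -/
noncomputable def invGaussianKernel (a t : ℝ) : ℝ := (√t)⁻¹ * Real.exp (-(t + a ^ 2 / t) / 2)

theorem invGaussianKernel_nonneg (a t : ℝ) : 0 ≤ invGaussianKernel a t := by
  unfold invGaussianKernel; positivity

theorem measurable_invGaussianKernel (a : ℝ) : Measurable (invGaussianKernel a) := by
  unfold invGaussianKernel; fun_prop

open MeasureTheory Set in
-- The involution `t ↦ a² / t` of the half-line preserves `t + a² / t`, and its Jacobian accounts
-- for the factor `a / t`.
theorem lintegral_invGaussianKernel_inversion {a : ℝ} (ha : 0 < a) :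
    ∫⁻ t in Ioi (0 : ℝ), ENNReal.ofReal (a / t * invGaussianKernel a t) =
      ∫⁻ t in Ioi (0 : ℝ), ENNReal.ofReal (invGaussianKernel a t) := by
  have himg : (fun t : ℝ => a ^ 2 / t) '' Ioi 0 = Ioi 0 := by
    ext x
    simp only [mem_image, mem_Ioi]
    constructor
    · rintro ⟨t, ht, rfl⟩; positivity
    · intro hx
      refine ⟨a ^ 2 / x, by positivity, by field_simp⟩
  have hder : ∀ t ∈ Ioi (0 : ℝ),
      HasDerivWithinAt (fun t : ℝ => a ^ 2 / t) (-(a ^ 2 / t ^ 2)) (Ioi 0) t := by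
    intro t ht
    have ht' : t ≠ 0 := ne_of_gt ht
    have := ((hasDerivAt_inv ht').const_mul (a ^ 2)).hasDerivWithinAt (s := Ioi 0)
    convert! this using 1
    ring
  have hinj : InjOn (fun t : ℝ => a ^ 2 / t) (Ioi 0) := by
    intro x hx y hy h
    have hx' : x ≠ 0 := ne_of_gt hx
    have hy' : y ≠ 0 := ne_of_gt hy
    have h' : a ^ 2 / x = a ^ 2 / y := h
    field_simp at h'
    exact h'.symm
  have key := lintegral_image_eq_lintegral_abs_deriv_mul measurableSet_Ioi hder hinj
    (fun t => ENNReal.ofReal (a / t * invGaussianKernel a t))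
  rw [himg] at key
  rw [key]
  refine setLIntegral_congr_fun measurableSet_Ioi fun t ht => ?_
  have ht0 : (0 : ℝ) < t := ht
  rw [← ENNReal.ofReal_mul (abs_nonneg _)]
  congr 1
  unfold invGaussianKernel
  have hs : √(a ^ 2 / t) = a / √t := by
    rw [Real.sqrt_div (by positivity), Real.sqrt_sq ha.le]
  have hs0 : 0 < √t := Real.sqrt_pos.2 ht0
  have hst : √t ^ 2 = t := Real.sq_sqrt ht0.le
  rw [hs, abs_neg, abs_of_pos (by positivity)]
  have he : -(a ^ 2 / t + a ^ 2 / (a ^ 2 / t)) / 2 = -(t + a ^ 2 / t) / 2 := by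
    field_simp; ring
  rw [he]
  have : a ^ 2 / t ^ 2 * (a / (a ^ 2 / t) * (a / √t)⁻¹) = (√t)⁻¹ := by
    field_simp
    rw [hst]
  rw [← this]; ring

open MeasureTheory Set in
-- Substitute `y = √t - a / √t`, which is increasing: then `t + a² / t = y² + 2 a` and `dy = (1 + a
-- / t) / (2 √t) dt`, so the sum of the two kernels is exactly a Gaussian in `y`. By the inversion
-- both summands have the same integral, so each accounts for half of the bound.
theorem lintegral_invGaussianKernel_add_le {a : ℝ} (ha : 0 < a) :
    ∫⁻ t in Ioi (0 : ℝ), ENNReal.ofReal (invGaussianKernel a t + a / t * invGaussianKernel a t) ≤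
      ENNReal.ofReal (2 * (√(2 * Real.pi) * Real.exp (-a))) := by
  have hder : ∀ t ∈ Ioi (0 : ℝ), HasDerivWithinAt (fun t : ℝ => √t - a / √t)
      ((√t)⁻¹ * (1 + a / t) / 2) (Ioi 0) t := by
    intro t ht
    have ht0 : (0 : ℝ) < t := ht
    have hs0 : 0 < √t := Real.sqrt_pos.2 ht0
    have hst : √t ^ 2 = t := Real.sq_sqrt ht0.le
    have h1 := Real.hasDerivAt_sqrt ht0.ne'
    have h2 := (h1.sub ((h1.inv hs0.ne').const_mul a)).hasDerivWithinAt (s := Ioi 0)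
    convert! h2 using 1
    rw [hst]
    field_simp
    ring
  have hmono : StrictMonoOn (fun t : ℝ => √t - a / √t) (Ioi 0) := by
    intro x hx y hy hxy
    have hx0 : 0 < √x := Real.sqrt_pos.2 hx
    have h1 : √x < √y := Real.sqrt_lt_sqrt (le_of_lt hx) hxy
    have h2 : a / √y < a / √x := div_lt_div_of_pos_left ha hx0 h1
    simp only
    linarith
  have key := lintegral_image_eq_lintegral_abs_deriv_mul measurableSet_Ioi hder hmono.injOn
    (fun y => ENNReal.ofReal (2 * Real.exp (-a)) * ENNReal.ofReal (Real.exp (-y ^ 2 / 2)))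
  have h1 : ∫⁻ t in Ioi (0 : ℝ),
      ENNReal.ofReal (invGaussianKernel a t + a / t * invGaussianKernel a t) =
      ∫⁻ y in (fun t : ℝ => √t - a / √t) '' Ioi 0,
        ENNReal.ofReal (2 * Real.exp (-a)) * ENNReal.ofReal (Real.exp (-y ^ 2 / 2)) := by
    rw [key]
    refine setLIntegral_congr_fun measurableSet_Ioi fun t ht => ?_
    have ht0 : (0 : ℝ) < t := ht
    have hs0 : 0 < √t := Real.sqrt_pos.2 ht0
    have hst : √t ^ 2 = t := Real.sq_sqrt ht0.le
    rw [abs_of_pos (by positivity), ← ENNReal.ofReal_mul (by positivity),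
      ← ENNReal.ofReal_mul (by positivity)]
    congr 1
    unfold invGaussianKernel
    have he : -(t + a ^ 2 / t) / 2 = -a + -(√t - a / √t) ^ 2 / 2 := by
      have : (√t - a / √t) ^ 2 = t - 2 * a + a ^ 2 / t := by
        rw [sub_sq, div_pow, hst]
        field_simp
      rw [this]; ring
    rw [he, Real.exp_add]
    ring
  rw [h1]
  calc _ ≤ ∫⁻ y : ℝ, ENNReal.ofReal (2 * Real.exp (-a)) * ENNReal.ofReal (Real.exp (-y ^ 2 / 2)) :=
        setLIntegral_le_lintegral _ _
    _ = _ := by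
        rw [lintegral_const_mul _ (by fun_prop), lintegral_gaussian_half,
          ← ENNReal.ofReal_mul (by positivity)]
        congr 1; ring

open MeasureTheory Set in
theorem lintegral_invGaussianKernel_le_of_pos {a : ℝ} (ha : 0 < a) :
    ∫⁻ t in Ioi (0 : ℝ), ENNReal.ofReal (invGaussianKernel a t) ≤
      ENNReal.ofReal (√(2 * Real.pi) * Real.exp (-a)) := by
  have h := lintegral_invGaussianKernel_add_le ha
  have h2 : ∫⁻ t in Ioi (0 : ℝ),
      ENNReal.ofReal (invGaussianKernel a t + a / t * invGaussianKernel a t) =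
      2 * ∫⁻ t in Ioi (0 : ℝ), ENNReal.ofReal (invGaussianKernel a t) := by
    rw [two_mul]
    nth_rewrite 2 [← lintegral_invGaussianKernel_inversion ha]
    rw [← lintegral_add_left (measurable_invGaussianKernel a).ennreal_ofReal]
    refine setLIntegral_congr_fun measurableSet_Ioi fun t ht => ?_
    have ht0 : (0 : ℝ) < t := ht
    exact ENNReal.ofReal_add (invGaussianKernel_nonneg a t)
      (mul_nonneg (by positivity) (invGaussianKernel_nonneg a t))
  rw [h2, ENNReal.ofReal_mul (by norm_num), ENNReal.ofReal_ofNat] at h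
  exact (ENNReal.mul_le_mul_iff_right (by norm_num) (by norm_num)).1 h

open MeasureTheory Set in
theorem lintegral_invGaussianKernel_zero_le :
    ∫⁻ t in Ioi (0 : ℝ), ENNReal.ofReal (invGaussianKernel 0 t) ≤
      ENNReal.ofReal √(2 * Real.pi) := by
  have hder : ∀ t ∈ Ioi (0 : ℝ), HasDerivWithinAt (fun t : ℝ => √t) (1 / (2 * √t)) (Ioi 0) t :=
    fun t ht => (Real.hasDerivAt_sqrt (ne_of_gt ht)).hasDerivWithinAt
  have hmono : StrictMonoOn (fun t : ℝ => √t) (Ioi 0) := fun x hx y hy hxy =>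
    Real.sqrt_lt_sqrt (le_of_lt hx) hxy
  have key := lintegral_image_eq_lintegral_abs_deriv_mul measurableSet_Ioi hder hmono.injOn
    (fun y => ENNReal.ofReal 2 * ENNReal.ofReal (Real.exp (-y ^ 2 / 2)))
  have h1 : ∫⁻ t in Ioi (0 : ℝ), ENNReal.ofReal (invGaussianKernel 0 t) =
      ∫⁻ y in (fun t : ℝ => √t) '' Ioi 0,
        ENNReal.ofReal 2 * ENNReal.ofReal (Real.exp (-y ^ 2 / 2)) := by
    rw [key]
    refine setLIntegral_congr_fun measurableSet_Ioi fun t ht => ?_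
    have ht0 : (0 : ℝ) < t := ht
    have hs0 : 0 < √t := Real.sqrt_pos.2 ht0
    have hst : √t ^ 2 = t := Real.sq_sqrt ht0.le
    rw [abs_of_pos (by positivity), ← ENNReal.ofReal_mul (by positivity),
      ← ENNReal.ofReal_mul (by positivity)]
    congr 1
    unfold invGaussianKernel
    rw [hst]
    simp only [ne_eq, OfNat.ofNat_ne_zero, not_false_eq_true, zero_pow, zero_div, add_zero]
    field_simp
  have hsub : (fun t : ℝ => √t) '' Ioi 0 ⊆ Ioi 0 := by
    rintro _ ⟨t, ht, rfl⟩
    exact Real.sqrt_pos.2 ht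
  rw [h1]
  calc _ ≤ ∫⁻ y in Ioi (0 : ℝ), ENNReal.ofReal 2 * ENNReal.ofReal (Real.exp (-y ^ 2 / 2)) :=
        lintegral_mono_set hsub
    _ = _ := by
        rw [lintegral_const_mul _ (by fun_prop), lintegral_gaussian_half_Ioi,
          ← ENNReal.ofReal_mul (by positivity)]
        congr 1; ring

open MeasureTheory Set in
-- The kernel depends only on `|a|`, and `exp (-|a|) ≤ exp (-a)`. No sign of `a` is imposed, because
-- `a` will depend on an inverse matrix.
theorem lintegral_invGaussianKernel_le (a : ℝ) :
    ∫⁻ t in Ioi (0 : ℝ), ENNReal.ofReal (invGaussianKernel a t) ≤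
      ENNReal.ofReal (√(2 * Real.pi) * Real.exp (-a)) := by
  rcases eq_or_ne a 0 with rfl | ha
  · simpa using lintegral_invGaussianKernel_zero_le
  · have h := lintegral_invGaussianKernel_le_of_pos (abs_pos.2 ha)
    have e : invGaussianKernel |a| = invGaussianKernel a := by
      funext t; simp [invGaussianKernel]
    rw [e] at h
    refine h.trans (ENNReal.ofReal_le_ofReal ?_)
    gcongr
    exact le_abs_self a

open MeasureTheory Set in
theorem lintegral_div_mul_invGaussianKernel_le (a : ℝ) :
    ∫⁻ t in Ioi (0 : ℝ), ENNReal.ofReal (a / t * invGaussianKernel a t) ≤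
      ENNReal.ofReal (√(2 * Real.pi) * Real.exp (-a)) := by
  rcases le_or_gt a 0 with ha | ha
  · have : ∫⁻ t in Ioi (0 : ℝ), ENNReal.ofReal (a / t * invGaussianKernel a t) =
        ∫⁻ t in Ioi (0 : ℝ), 0 := by
      refine setLIntegral_congr_fun measurableSet_Ioi fun t ht => ENNReal.ofReal_of_nonpos ?_
      exact mul_nonpos_of_nonpos_of_nonneg (div_nonpos_of_nonpos_of_nonneg ha (le_of_lt ht))
        (invGaussianKernel_nonneg a t)
    rw [this]; simp
  · rw [lintegral_invGaussianKernel_inversion ha]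
    exact lintegral_invGaussianKernel_le_of_pos ha

/-! ### Densities on operators with positive principal minors -/

/-- All principal minors of `H` are positive. -/
def PrincipalMinorsPos {ι : Type*} (H : Matrix ι ι ℝ) : Prop :=
  ∀ (n : ℕ) (f : Fin n ↪ ι), 0 < (H.submatrix f f).det

theorem PrincipalMinorsPos.submatrix {ι κ : Type*} {H : Matrix ι ι ℝ} (h : PrincipalMinorsPos H)
    (g : κ ↪ ι) : PrincipalMinorsPos (H.submatrix g g) :=
  fun n f => h n (f.trans g)

theorem principalMinorsPos_submatrix_equiv {ι κ : Type*} {H : Matrix ι ι ℝ} (g : κ ≃ ι) :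
    PrincipalMinorsPos (H.submatrix g g) ↔ PrincipalMinorsPos H :=
  ⟨fun h => by simpa using h.submatrix g.symm.toEmbedding, fun h => h.submatrix g.toEmbedding⟩

theorem PrincipalMinorsPos.det_pos {ι : Type*} [Fintype ι] [DecidableEq ι] {H : Matrix ι ι ℝ}
    (h : PrincipalMinorsPos H) : 0 < H.det := by
  have := h _ (Fintype.equivFin ι).symm.toEmbedding
  rwa [Equiv.coe_toEmbedding, Matrix.det_submatrix_equiv_self] at this

theorem Matrix.PosDef.principalMinorsPos {ι : Type*} [Fintype ι] {H : Matrix ι ι ℝ}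
    (h : H.PosDef) : PrincipalMinorsPos H :=
  fun _ f => (h.submatrix f.injective).det_pos

/-- The density `exp (-(⟨1, H 1⟩ + ⟨η, H⁻¹ η⟩) / 2) / √(det H)`. -/
noncomputable def operatorDensity {ι : Type*} [Fintype ι] [DecidableEq ι] (H : Matrix ι ι ℝ)
    (η : ι → ℝ) : ℝ :=
  Real.exp (-((1 : ι → ℝ) ⬝ᵥ H.mulVec 1 + η ⬝ᵥ H⁻¹.mulVec η) / 2) / √H.det

open Classical in
/-- The density `operatorDensity`, restricted to matrices with positive principal minors. -/
noncomputable def restrictedDensity {ι : Type*} [Fintype ι] [DecidableEq ι] (H : Matrix ι ι ℝ)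
    (η : ι → ℝ) : ENNReal :=
  if PrincipalMinorsPos H then ENNReal.ofReal (operatorDensity H η) else 0

theorem operatorDensity_nonneg {ι : Type*} [Fintype ι] [DecidableEq ι] (H : Matrix ι ι ℝ)
    (η : ι → ℝ) : 0 ≤ operatorDensity H η := by
  unfold operatorDensity; positivity

section Reindex
variable {ι κ : Type*} [Fintype ι] [DecidableEq ι] [Fintype κ] [DecidableEq κ]

theorem inv_submatrix_mulVec (H : Matrix ι ι ℝ) (η : ι → ℝ) (e : κ ≃ ι) (k : κ) :
    ((H.submatrix e e)⁻¹.mulVec (η ∘ e)) k = (H⁻¹.mulVec η) (e k) := by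
  rw [Matrix.inv_submatrix_equiv, Matrix.submatrix_mulVec_equiv]
  simp [Function.comp_def]

theorem operatorDensity_submatrix (H : Matrix ι ι ℝ) (η : ι → ℝ) (e : κ ≃ ι) :
    operatorDensity (H.submatrix e e) (η ∘ e) = operatorDensity H η := by
  unfold operatorDensity
  rw [Matrix.det_submatrix_equiv_self]
  have h1 : (η ∘ e) ⬝ᵥ (H.submatrix e e)⁻¹.mulVec (η ∘ e) = η ⬝ᵥ H⁻¹.mulVec η := by
    simp only [dotProduct, inv_submatrix_mulVec, Function.comp_apply]
    exact e.sum_comp fun i => η i * (H⁻¹.mulVec η) i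
  have h2 : (1 : κ → ℝ) ⬝ᵥ (H.submatrix e e).mulVec 1 = (1 : ι → ℝ) ⬝ᵥ H.mulVec 1 := by
    rw [Matrix.submatrix_mulVec_equiv]
    simp only [dotProduct, Pi.one_apply, one_mul, Function.comp_apply]
    exact e.sum_comp fun i => (H.mulVec ((1 : κ → ℝ) ∘ e.symm)) i
  rw [h1, h2]

theorem restrictedDensity_submatrix (H : Matrix ι ι ℝ) (η : ι → ℝ) (e : κ ≃ ι) :
    restrictedDensity (H.submatrix e e) (η ∘ e) = restrictedDensity H η := by
  unfold restrictedDensity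
  rw [operatorDensity_submatrix]
  classical exact if_congr (principalMinorsPos_submatrix_equiv e) rfl rfl

end Reindex

open MeasureTheory in
theorem lintegral_reindex {ι κ : Type*} [Fintype ι] [Fintype κ] (e : κ ≃ ι) (f : (ι → ℝ) → ENNReal) :
    ∫⁻ d : ι → ℝ, f d = ∫⁻ d : κ → ℝ, f (d ∘ e.symm) := by
  have h := volume_measurePreserving_piCongrLeft (fun _ : ι => ℝ) e
  rw [← h.lintegral_comp_emb (MeasurableEquiv.measurableEmbedding _)]
  congr 1; funext d; congr 1; funext i
  obtain ⟨k, rfl⟩ := e.surjective i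
  rw [MeasurableEquiv.coe_piCongrLeft, Equiv.piCongrLeft_apply_apply]
  simp

theorem continuous_add_diagonal {ι : Type*} [DecidableEq ι] (A : Matrix ι ι ℝ) :
    Continuous fun d : ι → ℝ => A + Matrix.diagonal d := by fun_prop

section Measurability
variable {ι : Type*} [Fintype ι] [DecidableEq ι]

theorem measurableSet_principalMinorsPos (A : Matrix ι ι ℝ) :
    MeasurableSet {d : ι → ℝ | PrincipalMinorsPos (A + Matrix.diagonal d)} := by
  simp only [PrincipalMinorsPos, Set.ofPred_forall]
  refine MeasurableSet.iInter fun n => MeasurableSet.iInter fun f => ?_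
  refine measurableSet_lt measurable_const (Continuous.measurable ?_)
  exact ((continuous_add_diagonal A).matrix_submatrix _ _).matrix_det

theorem measurable_inv_mulVec (A : Matrix ι ι ℝ) (η : ι → ℝ) (i : ι) :
    Measurable fun d : ι → ℝ => ((A + Matrix.diagonal d)⁻¹.mulVec η) i := by
  simp only [Matrix.inv_def, Ring.inverse_eq_inv', Matrix.smul_mulVec, Pi.smul_apply, smul_eq_mul]
  have h := continuous_add_diagonal A
  refine (Measurable.inv h.matrix_det.measurable).mul (Continuous.measurable ?_)
  exact (continuous_apply i).comp (h.matrix_adjugate.matrix_mulVec continuous_const)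

theorem measurable_operatorDensity (A : Matrix ι ι ℝ) (η : ι → ℝ) :
    Measurable fun d : ι → ℝ => operatorDensity (A + Matrix.diagonal d) η := by
  unfold operatorDensity
  have h := continuous_add_diagonal A
  refine Measurable.div (Real.measurable_exp.comp (((Measurable.add ?_ ?_).neg).div_const 2))
    h.matrix_det.measurable.sqrt
  · exact (Continuous.dotProduct continuous_const
      (h.matrix_mulVec continuous_const)).measurable
  · unfold dotProduct
    exact Finset.measurable_sum _ fun i _ => (measurable_inv_mulVec A η i).const_mul _

theorem measurable_restrictedDensity (A : Matrix ι ι ℝ) (η : ι → ℝ) :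
    Measurable fun d : ι → ℝ => restrictedDensity (A + Matrix.diagonal d) η := by
  classical
  unfold restrictedDensity
  exact Measurable.ite (measurableSet_principalMinorsPos A)
    (measurable_operatorDensity A η).ennreal_ofReal measurable_const

end Measurability

/-! ### Schur complement step -/

section Schur
variable {κ : Type*} [Fintype κ] [DecidableEq κ]

/-- The matrix with blocks `M`, `w`, `wᵀ`, and last diagonal entry `t + ⟨w, M⁻¹ w⟩`, so that `t`
is the Schur complement. -/
noncomputable def bordered (M : Matrix κ κ ℝ) (w : κ → ℝ) (t : ℝ) :
    Matrix (κ ⊕ Unit) (κ ⊕ Unit) ℝ :=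
  Matrix.fromBlocks M (Matrix.of fun i _ => w i) (Matrix.of fun _ j => w j)
    (Matrix.of fun _ _ => t + w ⬝ᵥ M⁻¹.mulVec w)

theorem det_bordered {M : Matrix κ κ ℝ} (hM : M.det ≠ 0) (w : κ → ℝ) (t : ℝ) :
    (bordered M w t).det = M.det * t := by
  have := M.invertibleOfIsUnitDet (isUnit_iff_ne_zero.2 hM)
  rw [bordered, Matrix.det_fromBlocks₁₁, Matrix.invOf_eq_nonsing_inv]
  congr 1
  rw [Matrix.det_unique]
  simp only [Matrix.sub_apply, Matrix.of_apply, Matrix.mul_apply, dotProduct, Matrix.mulVec,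
    Finset.mul_sum, Finset.sum_mul]
  rw [Finset.sum_comm]
  simp [mul_assoc]

theorem bordered_mulVec_elim (M : Matrix κ κ ℝ) (w : κ → ℝ) (t : ℝ) (x : κ → ℝ) (b : ℝ) :
    (bordered M w t).mulVec (Sum.elim x fun _ => b) =
      Sum.elim (M.mulVec x + b • w) fun _ => w ⬝ᵥ x + (t + w ⬝ᵥ M⁻¹.mulVec w) * b := by
  funext i
  rcases i with i | i
  · simp [bordered, Matrix.mulVec, dotProduct, mul_comm]
  · simp [bordered, Matrix.mulVec, dotProduct]

/-- Block elimination, checked by applying the bordered matrix to the claimed solution. The last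
coordinate `a / t` is the factor that turns the mass integral into the first moment. -/
theorem bordered_inv_mulVec {M : Matrix κ κ ℝ} (hM : M.det ≠ 0) (w : κ → ℝ) {t : ℝ}
    (ht : t ≠ 0) (η : κ → ℝ) (b : ℝ) :
    (bordered M w t)⁻¹.mulVec (Sum.elim η fun _ => b) =
      Sum.elim (M⁻¹.mulVec η - ((b - w ⬝ᵥ M⁻¹.mulVec η) / t) • M⁻¹.mulVec w)
        fun _ => (b - w ⬝ᵥ M⁻¹.mulVec η) / t := by
  have hdet : (bordered M w t).det ≠ 0 := by
    rw [det_bordered hM]; exact mul_ne_zero hM ht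
  set a := b - w ⬝ᵥ M⁻¹.mulVec η with ha
  have hMi : ∀ v : κ → ℝ, M.mulVec (M⁻¹.mulVec v) = v := fun v => by
    rw [Matrix.mulVec_mulVec, Matrix.mul_nonsing_inv _ (isUnit_iff_ne_zero.2 hM),
      Matrix.one_mulVec]
  have key : (bordered M w t).mulVec (Sum.elim (M⁻¹.mulVec η - (a / t) • M⁻¹.mulVec w)
      fun _ => a / t) = Sum.elim η fun _ => b := by
    rw [bordered_mulVec_elim, Matrix.mulVec_sub, Matrix.mulVec_smul, hMi, hMi]
    congr 1
    · simp
    · funext _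
      rw [dotProduct_sub, dotProduct_smul, smul_eq_mul]
      field_simp
      rw [ha]; ring
  rw [← key, Matrix.mulVec_mulVec, Matrix.nonsing_inv_mul _ (isUnit_iff_ne_zero.2 hdet),
    Matrix.one_mulVec]

theorem dotProduct_inv_mulVec_comm {M : Matrix κ κ ℝ} (hM : M.IsSymm) (x y : κ → ℝ) :
    x ⬝ᵥ M⁻¹.mulVec y = y ⬝ᵥ M⁻¹.mulVec x := by
  rw [Matrix.dotProduct_mulVec, ← Matrix.mulVec_transpose, Matrix.transpose_nonsing_inv, hM.eq,
    dotProduct_comm]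

/-- The two quadratic forms contribute `t + ⟨w, M⁻¹ w⟩` and `a² / t` beyond their values for `M` and
the term `2 ⟨w, 1⟩`. The term `⟨w, M⁻¹ w⟩` completes the square `⟨η - w, M⁻¹ (η - w)⟩`, so
eliminating a vertex replaces `η` by `η - w` and confines `t` to a single inverse Gaussian factor.
-/
theorem operatorDensity_bordered {M : Matrix κ κ ℝ} (hS : M.IsSymm) (hM : 0 < M.det) (w : κ → ℝ)
    {t : ℝ} (ht : 0 < t) (η : κ → ℝ) (b : ℝ) :
    operatorDensity (bordered M w t) (Sum.elim η fun _ => b) =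
      Real.exp (-b - w ⬝ᵥ 1) * operatorDensity M (η - w) *
        (Real.exp (b - w ⬝ᵥ M⁻¹.mulVec η) * invGaussianKernel (b - w ⬝ᵥ M⁻¹.mulVec η) t) := by
  unfold operatorDensity invGaussianKernel
  rw [bordered_inv_mulVec hM.ne' w ht.ne', det_bordered hM.ne', Real.sqrt_mul hM.le]
  have h1 : (1 : κ ⊕ Unit → ℝ) = Sum.elim (1 : κ → ℝ) fun _ => 1 := by
    funext i; rcases i <;> rfl
  have hs : ∀ (x y : κ → ℝ) (r z : ℝ),
      (Sum.elim x fun _ : Unit => r) ⬝ᵥ (Sum.elim y fun _ => z) = x ⬝ᵥ y + r * z := by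
    intro x y r z
    simp [dotProduct]
  rw [h1, bordered_mulVec_elim, hs, hs]
  have hc := dotProduct_inv_mulVec_comm hS η w
  have e2 : (η - w) ⬝ᵥ M⁻¹.mulVec (η - w) =
      η ⬝ᵥ M⁻¹.mulVec η - 2 * (w ⬝ᵥ M⁻¹.mulVec η) + w ⬝ᵥ M⁻¹.mulVec w := by
    rw [Matrix.mulVec_sub, sub_dotProduct, dotProduct_sub, dotProduct_sub, hc]; ring
  rw [e2, dotProduct_sub, dotProduct_smul, hc, dotProduct_add, dotProduct_smul, smul_eq_mul,
    smul_eq_mul, dotProduct_comm 1 w]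
  set p := w ⬝ᵥ M⁻¹.mulVec η
  set a := b - p with ha
  have hb : b = a + p := by rw [ha]; ring
  rw [hb]
  have : ∀ x y z e f S T : ℝ, Real.exp x * (Real.exp y / S) * (Real.exp z * (T⁻¹ * Real.exp e)) =
      Real.exp (x + y + z + e) / (S * T) := by
    intro x y z e f S T
    rw [Real.exp_add, Real.exp_add, Real.exp_add]
    field_simp
  rw [this _ _ _ _ 0]
  congr 2
  field_simp
  ring

theorem eq_bordered_of_isSymm (A : Matrix (κ ⊕ Unit) (κ ⊕ Unit) ℝ) (hA : A.IsSymm) (d : κ → ℝ)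
    (t : ℝ) :
    A + Matrix.diagonal (Sum.elim d fun _ => t +
        ((fun k => A (.inl k) (.inr ())) ⬝ᵥ
          (A.toBlocks₁₁ + Matrix.diagonal d)⁻¹.mulVec (fun k => A (.inl k) (.inr ())) -
          A (.inr ()) (.inr ()))) =
      bordered (A.toBlocks₁₁ + Matrix.diagonal d) (fun k => A (.inl k) (.inr ())) t := by
  ext i j
  rcases i with i | i <;> rcases j with j | j
  · by_cases h : i = j
    · subst h; simp [bordered, Matrix.toBlocks₁₁]
    · simp [bordered, Matrix.toBlocks₁₁, h]
  · simp [bordered]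
  · simp [bordered, hA.apply]
  · simp [bordered]; ring

/-- Positivity of `t` comes from `det = det M * t`. Only this implication is needed, since enlarging
the domain of integration preserves upper bounds. -/
theorem PrincipalMinorsPos.of_bordered {M : Matrix κ κ ℝ} {w : κ → ℝ} {t : ℝ}
    (h : PrincipalMinorsPos (bordered M w t)) : PrincipalMinorsPos M ∧ 0 < t := by
  have h1 : PrincipalMinorsPos M := h.submatrix Function.Embedding.inl
  refine ⟨h1, ?_⟩
  have h2 := h.det_pos
  rw [det_bordered h1.det_pos.ne'] at h2
  exact (mul_pos_iff_of_pos_left h1.det_pos).1 h2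

end Schur

/-! ### Integrating out the diagonal one vertex at a time -/

open MeasureTheory in
theorem lintegral_sum_unit {κ : Type*} [Fintype κ] {f : (κ ⊕ Unit → ℝ) → ENNReal}
    (hf : Measurable f) :
    ∫⁻ d, f d = ∫⁻ d : κ → ℝ, ∫⁻ t : ℝ, f (Sum.elim d fun _ => t) := by
  have h := volume_measurePreserving_sumPiEquivProdPi_symm (fun _ : κ ⊕ Unit => ℝ)
  rw [← h.lintegral_comp_emb (MeasurableEquiv.measurableEmbedding _), Measure.volume_eq_prod,
    lintegral_prod]
  · congr 1; funext d
    have h2 := (volume_preserving_funUnique Unit ℝ).symm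
    rw [← h2.lintegral_comp_emb (MeasurableEquiv.measurableEmbedding _)]
    rfl
  · exact (hf.comp (MeasurableEquiv.measurable _)).aemeasurable

open MeasureTheory in
-- Common step for the mass and the first moment: both kernels, with and without the factor `a / t`,
-- satisfy the same bound by `√(2π) exp (-a)`, so the one-vertex integration is done for an abstract
-- `Ψ`.
theorem lintegral_le_of_bordered_bound {κ : Type*} [Fintype κ] [DecidableEq κ]
    {A : Matrix (κ ⊕ Unit) (κ ⊕ Unit) ℝ} (hA : A.IsSymm) (η : κ → ℝ) (b : ℝ) {w : κ → ℝ}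
    (hw : w = fun k => A (.inl k) (.inr ()))
    {J : (κ ⊕ Unit → ℝ) → ENNReal} (hJm : Measurable J) {Ψ : ℝ → ℝ → ℝ}
    (hΨm : ∀ a, Measurable (Ψ a))
    (hΨ : ∀ a, ∫⁻ t in Set.Ioi (0 : ℝ), ENNReal.ofReal (Ψ a t) ≤
      ENNReal.ofReal (√(2 * Real.pi) * Real.exp (-a)))
    (hJ0 : ∀ d, ¬ PrincipalMinorsPos (A + Matrix.diagonal d) → J d = 0)
    (hJ : ∀ (M : Matrix κ κ ℝ) (d : κ ⊕ Unit → ℝ) (t : ℝ), M.IsSymm → PrincipalMinorsPos M → 0 < t →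
      A + Matrix.diagonal d = bordered M w t →
      J d ≤ ENNReal.ofReal (Real.exp (-b - w ⬝ᵥ 1) * operatorDensity M (η - w) *
        (Real.exp (b - w ⬝ᵥ M⁻¹.mulVec η) * Ψ (b - w ⬝ᵥ M⁻¹.mulVec η) t))) :
    ∫⁻ d, J d ≤ ENNReal.ofReal (√(2 * Real.pi) * Real.exp (-b - w ⬝ᵥ 1)) *
      ∫⁻ d, restrictedDensity (A.toBlocks₁₁ + Matrix.diagonal d) (η - w) := by
  rw [lintegral_sum_unit hJm, ← lintegral_const_mul _ (measurable_restrictedDensity _ _)]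
  refine lintegral_mono fun d => ?_
  simp only
  set M := A.toBlocks₁₁ + Matrix.diagonal d with hM
  have hMs : M.IsSymm := by
    refine Matrix.IsSymm.add ?_ (Matrix.isSymm_diagonal d)
    exact Matrix.IsSymm.ext fun i j => hA.apply _ _
  have hb := eq_bordered_of_isSymm A hA d
  rw [← hw, ← hM] at hb
  -- With `d` fixed, a translation turns the last diagonal entry into the Schur complement `t`.
  rw [← lintegral_add_right_eq_self _ (w ⬝ᵥ M⁻¹.mulVec w - A (.inr ()) (.inr ()))]
  unfold restrictedDensity
  split_ifs with hP
  · set a := b - w ⬝ᵥ M⁻¹.mulVec η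
    have hC : 0 ≤ Real.exp (-b - w ⬝ᵥ 1) * operatorDensity M (η - w) :=
      mul_nonneg (Real.exp_pos _).le (operatorDensity_nonneg _ _)
    calc _ ≤ ∫⁻ t, (Set.Ioi (0 : ℝ)).indicator (fun t =>
          ENNReal.ofReal (Real.exp (-b - w ⬝ᵥ 1) * operatorDensity M (η - w) * Real.exp a) *
            ENNReal.ofReal (Ψ a t)) t := by
          refine lintegral_mono fun t => ?_
          by_cases ht : 0 < t
          · rw [Set.indicator_of_mem (show t ∈ Set.Ioi (0 : ℝ) from ht),
              ← ENNReal.ofReal_mul (mul_nonneg hC (Real.exp_pos _).le), mul_assoc _ (Real.exp a)]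
            exact hJ M _ t hMs hP ht (hb t)
          · rw [hJ0]
            · exact zero_le
            · rw [hb]
              exact fun h => ht h.of_bordered.2
      _ ≤ ENNReal.ofReal (Real.exp (-b - w ⬝ᵥ 1) * operatorDensity M (η - w) * Real.exp a) *
            ENNReal.ofReal (√(2 * Real.pi) * Real.exp (-a)) := by
          rw [lintegral_indicator measurableSet_Ioi,
            lintegral_const_mul _ (hΨm a).ennreal_ofReal]
          gcongr
          exact hΨ a
      -- The factors `exp a` and `exp (-a)` cancel, leaving the density of `M` times a constant
      -- independent of `d`.
      _ = _ := by
          rw [← ENNReal.ofReal_mul (mul_nonneg hC (Real.exp_pos _).le),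
            ← ENNReal.ofReal_mul (by positivity)]
          congr 1
          rw [Real.exp_neg a]
          field_simp
  · rw [mul_zero, nonpos_iff_eq_zero, lintegral_eq_zero_of_ae_eq_zero]
    refine Filter.Eventually.of_forall fun t => hJ0 _ ?_
    rw [hb]
    exact fun h => hP h.of_bordered.1

open MeasureTheory in
theorem lintegral_restrictedDensity_sum_unit_le {κ : Type*} [Fintype κ] [DecidableEq κ]
    {A : Matrix (κ ⊕ Unit) (κ ⊕ Unit) ℝ} (hA : A.IsSymm) (η : κ → ℝ) (b : ℝ) :
    ∫⁻ d, restrictedDensity (A + Matrix.diagonal d) (Sum.elim η fun _ => b) ≤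
      ENNReal.ofReal (√(2 * Real.pi) * Real.exp (-b - (fun k => A (.inl k) (.inr ())) ⬝ᵥ 1)) *
      ∫⁻ d, restrictedDensity (A.toBlocks₁₁ + Matrix.diagonal d)
        (η - fun k => A (.inl k) (.inr ())) := by
  refine lintegral_le_of_bordered_bound hA η b rfl (measurable_restrictedDensity _ _)
    measurable_invGaussianKernel lintegral_invGaussianKernel_le ?_ ?_
  · intro d hd
    rw [restrictedDensity, if_neg hd]
  · intro M d t hMs hM ht hd
    rw [hd, restrictedDensity]
    split_ifs
    · rw [operatorDensity_bordered hMs hM.det_pos _ ht]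
    · exact zero_le

open MeasureTheory in
theorem lintegral_inv_mul_restrictedDensity_sum_unit_le {κ : Type*} [Fintype κ] [DecidableEq κ]
    {A : Matrix (κ ⊕ Unit) (κ ⊕ Unit) ℝ} (hA : A.IsSymm) (η : κ → ℝ) (b : ℝ) :
    ∫⁻ d, ENNReal.ofReal
        (((A + Matrix.diagonal d)⁻¹.mulVec (Sum.elim η fun _ => b)) (.inr ())) *
        restrictedDensity (A + Matrix.diagonal d) (Sum.elim η fun _ => b) ≤
      ENNReal.ofReal (√(2 * Real.pi) * Real.exp (-b - (fun k => A (.inl k) (.inr ())) ⬝ᵥ 1)) *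
      ∫⁻ d, restrictedDensity (A.toBlocks₁₁ + Matrix.diagonal d)
        (η - fun k => A (.inl k) (.inr ())) := by
  refine lintegral_le_of_bordered_bound hA η b rfl
    ((measurable_inv_mulVec _ _ _).ennreal_ofReal.mul (measurable_restrictedDensity _ _))
    (Ψ := fun a t => a / t * invGaussianKernel a t)
    (fun a => (measurable_const.div measurable_id).mul (measurable_invGaussianKernel a))
    lintegral_div_mul_invGaussianKernel_le ?_ ?_
  · intro d hd
    rw [restrictedDensity, if_neg hd, mul_zero]
  · intro M d t hMs hM ht hd
    rw [hd, restrictedDensity]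
    split_ifs
    · rw [operatorDensity_bordered hMs hM.det_pos _ ht,
        bordered_inv_mulVec hM.det_pos.ne' _ ht.ne', Sum.elim_inr,
        ← ENNReal.ofReal_mul' (mul_nonneg (mul_nonneg (Real.exp_pos _).le
          (operatorDensity_nonneg _ _)) (mul_nonneg (Real.exp_pos _).le
          (invGaussianKernel_nonneg _ _)))]
      apply le_of_eq
      congr 1; ring
    · rw [mul_zero]; exact zero_le

/-- Splitting off one element of a type. -/
noncomputable def splitOff {ι : Type*} [DecidableEq ι] (y : ι) : {i : ι // i ≠ y} ⊕ Unit ≃ ι :=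
  (Equiv.optionEquivSumPUnit _).symm.trans (Equiv.optionSubtypeNe y)

theorem splitOff_inr {ι : Type*} [DecidableEq ι] (y : ι) (i : Unit) : splitOff y (.inr i) = y := by
  simp [splitOff]

theorem splitOff_inl {ι : Type*} [DecidableEq ι] (y : ι) (i : {i : ι // i ≠ y}) :
    splitOff y (.inl i) = i := by
  simp [splitOff]

theorem add_diagonal_submatrix {ι κ : Type*} [DecidableEq ι] [DecidableEq κ] (A : Matrix ι ι ℝ) (d : κ → ℝ)
    (e : κ ≃ ι) :
    A + Matrix.diagonal (d ∘ e.symm) = (A.submatrix e e + Matrix.diagonal d).submatrix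
      e.symm e.symm := by
  ext i j
  by_cases h : i = j
  · subst h; simp
  · simp [h]

theorem sum_elim_comp_splitOff {ι : Type*} [DecidableEq ι] (η : ι → ℝ) (y : ι) :
    (Sum.elim (fun i : {i // i ≠ y} => η i) fun _ => η y) = η ∘ splitOff y := by
  funext i
  rcases i with i | i
  · simp [splitOff_inl]
  · simp [splitOff_inr]

theorem comp_splitOff_symm {ι : Type*} [DecidableEq ι] (η : ι → ℝ) (y : ι) :
    (Sum.elim (fun i : {i // i ≠ y} => η i) fun _ => η y) ∘ (splitOff y).symm = η := by
  rw [sum_elim_comp_splitOff]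
  funext i; simp

theorem isSymm_submatrix {ι κ : Type*} {A : Matrix ι ι ℝ} (hA : A.IsSymm) (f : κ → ι) :
    (A.submatrix f f).IsSymm := by
  rw [Matrix.IsSymm, Matrix.transpose_submatrix, hA.eq]

section
variable {ι : Type*} [Fintype ι] [DecidableEq ι]

theorem sum_split_off (η : ι → ℝ) (y : ι) : ∑ i, η i = ∑ i : {i // i ≠ y}, η i + η y := by
  rw [← (splitOff y).sum_comp, Fintype.sum_sum_type]
  simp [splitOff_inl, splitOff_inr]

theorem restrictedDensity_splitOff (A : Matrix ι ι ℝ) (η : ι → ℝ) (y : ι)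
    (d : {i : ι // i ≠ y} ⊕ Unit → ℝ) :
    restrictedDensity (A + Matrix.diagonal (d ∘ (splitOff y).symm)) η =
      restrictedDensity (A.submatrix (splitOff y) (splitOff y) + Matrix.diagonal d)
        (Sum.elim (fun i : {i // i ≠ y} => η i) fun _ => η y) := by
  rw [add_diagonal_submatrix, ← restrictedDensity_submatrix _ _ (splitOff y).symm,
    comp_splitOff_symm]

/-- The change from `η` to `η - w` is compensated by the factor `exp (-η y - ⟨w, 1⟩)`. Hence the
constant of the induction depends only on the sum of `η` and not on the matrix. -/
theorem bordered_step_constant (n : ℕ) (η : ι → ℝ) (y : ι)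
    (w : {i : ι // i ≠ y} → ℝ) :
    ENNReal.ofReal (√(2 * Real.pi) * Real.exp (-η y - w ⬝ᵥ 1)) *
      ENNReal.ofReal (√(2 * Real.pi) ^ n *
        Real.exp (-∑ i, ((fun i : {i // i ≠ y} => η i) - w) i)) =
      ENNReal.ofReal (√(2 * Real.pi) ^ (n + 1) * Real.exp (-∑ i, η i)) := by
  rw [← ENNReal.ofReal_mul (by positivity)]
  congr 1
  rw [sum_split_off η y]
  have : -(∑ i : {i // i ≠ y}, η i + η y) =
      (-η y - w ⬝ᵥ 1) + -∑ i, ((fun i : {i // i ≠ y} => η i) - w) i := by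
    simp [dotProduct, Finset.sum_sub_distrib]
    ring
  rw [this, Real.exp_add]
  ring

open MeasureTheory in
-- Induction on the number of vertices, each one contributing a factor `√(2π)`. Arbitrary `A` and
-- `η` are allowed because elimination changes both.
theorem lintegral_restrictedDensity_le (A : Matrix ι ι ℝ) (hA : A.IsSymm) (η : ι → ℝ) :
    ∫⁻ d, restrictedDensity (A + Matrix.diagonal d) η ≤
      ENNReal.ofReal (√(2 * Real.pi) ^ Fintype.card ι * Real.exp (-∑ i, η i)) := by
  induction hn : Fintype.card ι generalizing ι with
  | zero =>
    have := Fintype.card_eq_zero_iff.1 hn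
    rw [Measure.volume_pi_eq_dirac, lintegral_dirac' _ (measurable_restrictedDensity A η)]
    unfold restrictedDensity operatorDensity
    split_ifs <;> simp
  | succ n ih =>
    obtain ⟨y⟩ : Nonempty ι := Fintype.card_pos_iff.1 (by omega)
    rw [lintegral_reindex (splitOff y)]
    simp only [restrictedDensity_splitOff]
    refine (lintegral_restrictedDensity_sum_unit_le (isSymm_submatrix hA _) _ _).trans ?_
    rw [← bordered_step_constant n η y]
    gcongr
    refine ih _ (Matrix.IsSymm.ext fun i j => hA.apply _ _) _ ?_
    rw [Fintype.card_subtype_compl, Fintype.card_subtype_eq, hn]; rfl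

open MeasureTheory in
-- The vertex `y` is eliminated first, with the kernel carrying the extra factor `a / t`. Everything
-- that remains is a mass integral, so the moment inherits the bound of the mass.
theorem lintegral_inv_mul_restrictedDensity_le (A : Matrix ι ι ℝ) (hA : A.IsSymm) (η : ι → ℝ)
    (y : ι) :
    ∫⁻ d, ENNReal.ofReal (((A + Matrix.diagonal d)⁻¹.mulVec η) y) *
        restrictedDensity (A + Matrix.diagonal d) η ≤
      ENNReal.ofReal (√(2 * Real.pi) ^ Fintype.card ι * Real.exp (-∑ i, η i)) := by
  have hinv : ∀ d : {i : ι // i ≠ y} ⊕ Unit → ℝ,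
      ((A + Matrix.diagonal (d ∘ (splitOff y).symm))⁻¹.mulVec η) y =
      ((A.submatrix (splitOff y) (splitOff y) + Matrix.diagonal d)⁻¹.mulVec
        (Sum.elim (fun i : {i // i ≠ y} => η i) fun _ => η y)) (.inr ()) := by
    intro d
    have h := inv_submatrix_mulVec (A.submatrix (splitOff y) (splitOff y) + Matrix.diagonal d)
      (Sum.elim (fun i : {i // i ≠ y} => η i) fun _ => η y) (splitOff y).symm y
    rw [comp_splitOff_symm, ← add_diagonal_submatrix] at h
    rw [h, (Equiv.symm_apply_eq _).2 (splitOff_inr y ()).symm]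
  rw [lintegral_reindex (splitOff y)]
  simp only [restrictedDensity_splitOff, hinv]
  refine (lintegral_inv_mul_restrictedDensity_sum_unit_le (isSymm_submatrix hA _) _ _).trans ?_
  have hn : Fintype.card ι = Fintype.card {i // i ≠ y} + 1 := by
    have : 0 < Fintype.card ι := Fintype.card_pos_iff.2 ⟨y⟩
    rw [Fintype.card_subtype_compl, Fintype.card_subtype_eq]; omega
  rw [hn, ← bordered_step_constant _ η y]
  gcongr
  exact lintegral_restrictedDensity_le _ (Matrix.IsSymm.ext fun i j => hA.apply _ _) _
end

/-! ### Spanning trees and the Laplacian determinant -/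

/-- The extension of `f` to a self-map fixing `i₀`. -/
def rootedMap {V : Type*} [DecidableEq V] (i₀ : V) (f : {i : V // i ≠ i₀} → V) (i : V) : V :=
  if h : i = i₀ then i₀ else f ⟨i, h⟩

theorem rootedMap_root {V : Type*} [DecidableEq V] (i₀ : V) (f : {i : V // i ≠ i₀} → V) : rootedMap i₀ f i₀ = i₀ := by
  simp [rootedMap]

theorem rootedMap_coe {V : Type*} [DecidableEq V] (i₀ : V) (f : {i : V // i ≠ i₀} → V) (i : {i : V // i ≠ i₀}) :
    rootedMap i₀ f i = f i := by
  simp [rootedMap, i.2]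

section Trees
variable {V : Type*} [Fintype V] [DecidableEq V]

/-- The Laplacian with weights `c`, restricted to the vertices other than `i₀`. -/
noncomputable def reducedLaplacian (c : V → V → ℝ) (i₀ : V) :
    Matrix {i : V // i ≠ i₀} {i : V // i ≠ i₀} ℝ :=
  Matrix.of fun i j => (if i = j then ∑ k, c i k else 0) - c i j

/-- The matrix `1 - P` where `P` is the (killed at `i₀`) transition matrix of the map `f`. -/
noncomputable def functionLaplacian (i₀ : V) (f : {i : V // i ≠ i₀} → V) :
    Matrix {i : V // i ≠ i₀} {i : V // i ≠ i₀} ℝ :=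
  1 - Matrix.of fun i j : {i : V // i ≠ i₀} => if f i = j then 1 else 0

/-- All vertices are eventually sent to the root by `f`. -/
def ReachesRoot (i₀ : V) (f : {i : V // i ≠ i₀} → V) : Prop :=
  ∀ i, ∃ n, (rootedMap i₀ f)^[n] i = i₀

/-- Row `i` of the Laplacian is `∑ k, c i k (e_i - e_k)` with `e_{i₀} = 0`. Multilinearity in the
rows expands the determinant over the choices `f` of one outgoing edge at every vertex. -/
theorem det_reducedLaplacian (c : V → V → ℝ) (i₀ : V) :
    (reducedLaplacian c i₀).det =
      ∑ f : {i : V // i ≠ i₀} → V, (∏ i : {i : V // i ≠ i₀}, c i (f i)) * (functionLaplacian i₀ f).det := by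
  have h : reducedLaplacian c i₀ = fun i : {i : V // i ≠ i₀} => ∑ k : V, c i k •
      ((1 : Matrix {i : V // i ≠ i₀} {i : V // i ≠ i₀} ℝ) i - fun j : {i : V // i ≠ i₀} => if k = j then 1 else 0) := by
    funext i j
    simp only [reducedLaplacian, Matrix.of_apply, Finset.sum_apply, Pi.smul_apply, Pi.sub_apply,
      smul_eq_mul, mul_sub, Finset.sum_sub_distrib, Matrix.one_apply]
    simp
  have h2 := (Matrix.detRowAlternating (n := {i : V // i ≠ i₀}) (R := ℝ)).toMultilinearMap.map_sum
    (fun (i : {i : V // i ≠ i₀}) (k : V) => c i k •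
      ((1 : Matrix {i : V // i ≠ i₀} {i : V // i ≠ i₀} ℝ) i - fun j : {i : V // i ≠ i₀} =>
      if k = j then (1 : ℝ) else 0))
  rw [← h] at h2
  refine h2.trans (Finset.sum_congr rfl fun f _ => ?_)
  rw [MultilinearMap.map_smul_univ]
  rfl

theorem functionLaplacian_mulVec (i₀ : V) (f : {i : V // i ≠ i₀} → V) (x : V → ℝ)
    (hx : x i₀ = 0) (i : {i : V // i ≠ i₀}) :
    (functionLaplacian i₀ f).mulVec (fun j => x j) i = x i - x (f i) := by
  rw [functionLaplacian, Matrix.sub_mulVec, Matrix.one_mulVec, Pi.sub_apply]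
  congr 1
  simp only [Matrix.mulVec, dotProduct, Matrix.of_apply, ite_mul, one_mul, zero_mul]
  by_cases h : f i = i₀
  · rw [h, hx]
    exact Finset.sum_eq_zero fun j _ => if_neg fun h' => j.2 h'.symm
  · rw [Finset.sum_eq_single ⟨f i, h⟩]
    · simp
    · intro j _ hj
      exact if_neg fun h' => hj (Subtype.ext h'.symm)
    · simp

/-- The indicator of the vertices that never reach the root is invariant under `f`, hence a nonzero
kernel vector. -/
theorem det_functionLaplacian_of_not_reachesRoot {i₀ : V} {f : {i : V // i ≠ i₀} → V}
    (hf : ¬ ReachesRoot i₀ f) : (functionLaplacian i₀ f).det = 0 := by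
  classical
  unfold ReachesRoot at hf
  push Not at hf
  obtain ⟨i, hi⟩ := hf
  have hi0 : i ≠ i₀ := hi 0
  set x : V → ℝ := fun j => if ∃ n, (rootedMap i₀ f)^[n] j = i₀ then 0 else 1 with hx
  rw [← Matrix.exists_mulVec_eq_zero_iff]
  refine ⟨fun j => x j, fun h => ?_, ?_⟩
  · have := congrFun h ⟨i, hi0⟩
    simp [hx, hi] at this
  · funext j
    rw [functionLaplacian_mulVec i₀ f x (if_pos ⟨0, rfl⟩), Pi.zero_apply, sub_eq_zero, hx]
    refine if_congr ?_ rfl rfl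
    constructor
    · rintro ⟨n, hn⟩
      rcases n with _ | n
      · exact absurd hn j.2
      · exact ⟨n, by rwa [Function.iterate_succ_apply, rootedMap_coe] at hn⟩
    · rintro ⟨n, hn⟩
      exact ⟨n + 1, by rwa [Function.iterate_succ_apply, rootedMap_coe]⟩

theorem ReachesRoot.exists_uniform {i₀ : V} {f : {i : V // i ≠ i₀} → V}
    (hf : ReachesRoot i₀ f) : ∃ n, ∀ i, (rootedMap i₀ f)^[n] i = i₀ := by
  choose n hn using hf
  refine ⟨∑ i, n i, fun i => ?_⟩
  rw [← Finset.sum_erase_add _ _ (Finset.mem_univ i), Function.iterate_add_apply, hn]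
  exact Function.iterate_fixed (rootedMap_root i₀ f) _

theorem pow_transition_mulVec (i₀ : V) (f : {i : V // i ≠ i₀} → V) (x : V → ℝ) (hx : x i₀ = 0)
    (n : ℕ) (i : {i : V // i ≠ i₀}) :
    (((1 - functionLaplacian i₀ f) ^ n).mulVec fun j => x j) i = x ((rootedMap i₀ f)^[n] i) := by
  induction n generalizing x with
  | zero => simp
  | succ n ih =>
    rw [pow_succ, ← Matrix.mulVec_mulVec]
    have : (1 - functionLaplacian i₀ f).mulVec (fun j => x j) =
        fun j : {i : V // i ≠ i₀} => (fun j => x (rootedMap i₀ f j)) j := by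
      funext j
      change _ = x (rootedMap i₀ f j)
      rw [Matrix.sub_mulVec, Matrix.one_mulVec, Pi.sub_apply, functionLaplacian_mulVec i₀ f x hx,
        rootedMap_coe]
      ring
    rw [this, ih (fun j => x (rootedMap i₀ f j)) (by rw [rootedMap_root, hx]),
      ← Function.iterate_succ_apply' (rootedMap i₀ f)]

/-- Every orbit is absorbed at the root after boundedly many steps, so the killed transition matrix
`P` is nilpotent. Its characteristic polynomial is a power of `X`, whose value at `1` is `det (1 -
P)`. -/
theorem det_functionLaplacian_of_reachesRoot {i₀ : V} {f : {i : V // i ≠ i₀} → V}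
    (hf : ReachesRoot i₀ f) : (functionLaplacian i₀ f).det = 1 := by
  obtain ⟨n, hn⟩ := hf.exists_uniform
  set P := 1 - functionLaplacian i₀ f with hP
  have hnil : P ^ n = 0 := by
    refine Matrix.ext_of_mulVec_single fun j => ?_
    funext i
    have := pow_transition_mulVec i₀ f (Pi.single (j : V) 1) (by simp [j.2.symm]) n i
    rw [hn, Pi.single_eq_of_ne j.2.symm] at this
    rw [Matrix.zero_mulVec, Pi.zero_apply, ← this]
    congr 2
    funext k
    simp [Pi.single_apply, Subtype.ext_iff]
  have hnil' : IsNilpotent (Matrix.toLin' P) := ⟨n, by rw [← Matrix.toLin'_pow, hnil, map_zero]⟩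
  have hc := hnil'.charpoly_eq_X_pow_finrank
  rw [← LinearMap.charpoly_toMatrix _ (Pi.basisFun ℝ _), LinearMap.toMatrix_eq_toMatrix', LinearMap.toMatrix'_toLin'] at hc
  have he := congrArg (Polynomial.eval 1) hc
  rw [Matrix.eval_charpoly] at he
  simpa [hP] using he

theorem functionLaplacian_det_nonneg (i₀ : V) (f : {i : V // i ≠ i₀} → V) :
    0 ≤ (functionLaplacian i₀ f).det := by
  by_cases hf : ReachesRoot i₀ f
  · rw [det_functionLaplacian_of_reachesRoot hf]; exact zero_le_one
  · rw [det_functionLaplacian_of_not_reachesRoot hf]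

/-- The graph of `f`, as a set of directed edges. -/
def functionGraph (i₀ : V) (f : {i : V // i ≠ i₀} → V) : Finset (V × V) :=
  Finset.univ.image fun i : {i : V // i ≠ i₀} => ((i : V), f i)

theorem mem_functionGraph {i₀ : V} {f : {i : V // i ≠ i₀} → V} {a b : V} :
    (a, b) ∈ functionGraph i₀ f ↔ ∃ h : a ≠ i₀, f ⟨a, h⟩ = b := by
  simp only [functionGraph, Finset.mem_image, Finset.mem_univ, true_and, Prod.mk.injEq]
  constructor
  · rintro ⟨i, rfl, h⟩; exact ⟨i.2, h⟩
  · rintro ⟨h, h'⟩; exact ⟨⟨a, h⟩, rfl, h'⟩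

theorem functionGraph_injective (i₀ : V) :
    Function.Injective (functionGraph i₀ : ({i : V // i ≠ i₀} → V) → Finset (V × V)) := by
  intro f g h
  funext i
  have : ((i : V), f i) ∈ functionGraph i₀ g := h ▸ mem_functionGraph.2 ⟨i.2, rfl⟩
  obtain ⟨_, h'⟩ := mem_functionGraph.1 this
  exact h'.symm

theorem prod_functionGraph (i₀ : V) (f : {i : V // i ≠ i₀} → V) (c : V → V → ℝ) :
    ∏ e ∈ functionGraph i₀ f, c e.1 e.2 = ∏ i : {i : V // i ≠ i₀}, c i (f i) := by
  rw [functionGraph, Finset.prod_image]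
  intro i _ j _ h
  exact Subtype.ext (Prod.ext_iff.1 h).1

theorem IsSpanningTreeTowards.exists_function {G : SimpleGraph V} {i₀ : V} {T : Finset (V × V)}
    (hT : IsSpanningTreeTowards G i₀ T) : ∃ f, ReachesRoot i₀ f ∧ functionGraph i₀ f = T := by
  obtain ⟨-, h2, h3, h4⟩ := hT
  choose! g hg hg' using h2
  have hne : ∀ {a b}, (a, b) ∈ T → a ≠ i₀ := by
    rintro a b h rfl; exact h3 b h
  refine ⟨fun i => g i, fun i => ?_, ?_⟩
  · induction h4 i using Relation.ReflTransGen.head_induction_on with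
    | refl => exact ⟨0, rfl⟩
    | head hab _ ih =>
      obtain ⟨n, hn⟩ := ih
      refine ⟨n + 1, ?_⟩
      rw [Function.iterate_succ_apply]
      have := rootedMap_coe i₀ (fun i => g i) ⟨_, hne hab⟩
      simp only at this
      rw [this, ← hg' _ (hne hab) _ hab, hn]
  · ext ⟨a, b⟩
    rw [mem_functionGraph]
    constructor
    · rintro ⟨h, rfl⟩; exact hg a h
    · intro h
      exact ⟨hne h, (hg' a (hne h) b h).symm⟩

open Classical in
-- Spanning trees towards the root are graphs of functions all of whose orbits reach the root, and
-- these enter the expansion with determinant one. The other terms are nonnegative and are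
-- discarded.
theorem sum_spanningTree_le_det (G : SimpleGraph V) (i₀ : V) (c : V → V → ℝ)
    (hc : ∀ i j, 0 ≤ c i j) :
    ∑ T : Finset (V × V) with IsSpanningTreeTowards G i₀ T, ∏ e ∈ T, c e.1 e.2 ≤
      (reducedLaplacian c i₀).det := by
  rw [det_reducedLaplacian]
  calc _ ≤ ∑ T ∈ (Finset.univ.filter fun f => ReachesRoot i₀ f).image (functionGraph i₀),
        ∏ e ∈ T, c e.1 e.2 := by
        refine Finset.sum_le_sum_of_subset_of_nonneg ?_ fun T _ _ =>
          Finset.prod_nonneg fun e _ => hc _ _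
        intro T hT
        obtain ⟨f, hf, rfl⟩ := (Finset.mem_filter.1 hT).2.exists_function
        exact Finset.mem_image_of_mem _ (Finset.mem_filter.2 ⟨Finset.mem_univ _, hf⟩)
    _ = ∑ f with ReachesRoot i₀ f, (∏ i : {i : V // i ≠ i₀}, c i (f i)) * (functionLaplacian i₀ f).det := by
        rw [Finset.sum_image fun f _ g _ h => functionGraph_injective i₀ h]
        refine Finset.sum_congr rfl fun f hf => ?_
        rw [prod_functionGraph, det_functionLaplacian_of_reachesRoot (Finset.mem_filter.1 hf).2,
          mul_one]
    _ ≤ _ := by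
        refine Finset.sum_le_sum_of_subset_of_nonneg (Finset.filter_subset _ _) fun f _ _ => ?_
        exact mul_nonneg (Finset.prod_nonneg fun i _ => hc _ _) (functionLaplacian_det_nonneg _ _)

end Trees

/-! ### The change of variables from the field to the diagonal of the operator -/

section Field
variable {V : Type*} [DecidableEq V]

@[simp]
theorem extendByZero_root (i₀ : V) (x : {i : V // i ≠ i₀} → ℝ) : extendByZero i₀ x i₀ = 0 := by
  simp [extendByZero]

@[simp]
theorem extendByZero_coe (i₀ : V) (x : {i : V // i ≠ i₀} → ℝ) (i : {i : V // i ≠ i₀}) :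
    extendByZero i₀ x i = x i := by
  simp [extendByZero, i.2]

/-- The coordinate `x ↦ extendByZero i₀ x i` as a continuous linear map. -/
noncomputable def extendCoord (i₀ i : V) : ({i : V // i ≠ i₀} → ℝ) →L[ℝ] ℝ :=
  if h : i = i₀ then 0 else ContinuousLinearMap.proj ⟨i, h⟩

theorem extendCoord_apply (i₀ i : V) (x : {i : V // i ≠ i₀} → ℝ) :
    extendCoord i₀ i x = extendByZero i₀ x i := by
  unfold extendCoord extendByZero
  split_ifs <;> rfl

theorem continuous_extendByZero (i₀ : V) : Continuous (extendByZero i₀) := by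
  refine continuous_pi fun i => ?_
  exact (extendCoord i₀ i).continuous.congr fun x => extendCoord_apply i₀ i x

variable [Fintype V]

/-- The weights `a_{i,j} e^{u_j - u_i}`. -/
noncomputable def tiltedWeight (a : V → V → ℝ) (u : V → ℝ) (i j : V) : ℝ :=
  a i j * Real.exp (u j - u i)

/-- The off-diagonal part of the operator. -/
noncomputable def offDiagonal (a : V → V → ℝ) (i₀ : V) :
    Matrix {i : V // i ≠ i₀} {i : V // i ≠ i₀} ℝ :=
  Matrix.of fun i j => -a i j

/-- The diagonal of the operator, as a function of the field. -/
noncomputable def fieldDiagonal (a : V → V → ℝ) (i₀ : V) (x : {i : V // i ≠ i₀} → ℝ)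
    (i : {i : V // i ≠ i₀}) : ℝ :=
  ∑ j, tiltedWeight a (extendByZero i₀ x) i j

/-- The operator associated with the field. -/
noncomputable def fieldOperator (a : V → V → ℝ) (i₀ : V) (x : {i : V // i ≠ i₀} → ℝ) :
    Matrix {i : V // i ≠ i₀} {i : V // i ≠ i₀} ℝ :=
  offDiagonal a i₀ + Matrix.diagonal (fieldDiagonal a i₀ x)

theorem fieldOperator_mulVec (a : V → V → ℝ) (i₀ : V) (x f : {i : V // i ≠ i₀} → ℝ)
    (i : {i : V // i ≠ i₀}) : (fieldOperator a i₀ x).mulVec f i =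
      fieldDiagonal a i₀ x i * f i - ∑ j : {i : V // i ≠ i₀}, a i j * f j := by
  rw [fieldOperator, Matrix.add_mulVec, Pi.add_apply, Matrix.mulVec_diagonal]
  simp [Matrix.mulVec, dotProduct, offDiagonal]
  ring

/-- This identity recovers the field from the operator as `e^u = H⁻¹ η`. It gives the injectivity of
the change of variables, the formula for the energy and the first moment. -/
theorem fieldOperator_mulVec_exp (a : V → V → ℝ) (i₀ : V) (x : {i : V // i ≠ i₀} → ℝ) :
    (fieldOperator a i₀ x).mulVec (fun i => Real.exp (x i)) =
      fun i : {i : V // i ≠ i₀} => a i i₀ := by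
  funext i
  rw [fieldOperator_mulVec, fieldDiagonal, Finset.sum_mul, sum_split_off _ i₀]
  simp only [tiltedWeight, extendByZero_coe, extendByZero_root, mul_assoc, ← Real.exp_add]
  simp

theorem det_reducedLaplacian_eq (a : V → V → ℝ) (i₀ : V) (x : {i : V // i ≠ i₀} → ℝ) :
    (reducedLaplacian (tiltedWeight a (extendByZero i₀ x)) i₀).det =
      (fieldOperator a i₀ x).det := by
  have h : reducedLaplacian (tiltedWeight a (extendByZero i₀ x)) i₀ =
      Matrix.diagonal (fun i => Real.exp (-x i)) * fieldOperator a i₀ x *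
        Matrix.diagonal (fun i => Real.exp (x i)) := by
    ext i j
    rw [Matrix.mul_diagonal, Matrix.diagonal_mul]
    simp only [reducedLaplacian, fieldOperator, offDiagonal, fieldDiagonal, Matrix.of_apply,
      Matrix.add_apply, Matrix.diagonal_apply]
    have hij : tiltedWeight a (extendByZero i₀ x) i j =
        Real.exp (-x i) * a i j * Real.exp (x j) := by
      simp only [tiltedWeight, extendByZero_coe, sub_eq_add_neg, Real.exp_add]; ring
    rw [hij]
    split_ifs with h
    · subst h
      rw [Real.exp_neg]
      field_simp
      ring
    · ring
  rw [h, Matrix.det_mul, Matrix.det_mul, Matrix.det_diagonal, Matrix.det_diagonal, mul_right_comm,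
    ← Finset.prod_mul_distrib]
  simp [← Real.exp_add]

/-- The differential is minus the tilted Laplacian, which is conjugate to `fieldOperator` by a
diagonal matrix; up to sign the Jacobian is thus `det H`. -/
theorem hasFDerivAt_fieldDiagonal (a : V → V → ℝ) (i₀ : V) (x : {i : V // i ≠ i₀} → ℝ) :
    HasFDerivAt (fieldDiagonal a i₀)
      (-(Matrix.toLin' (reducedLaplacian (tiltedWeight a (extendByZero i₀ x)) i₀)).toContinuousLinearMap)
      x := by
  rw [hasFDerivAt_pi']
  intro i
  have h : HasFDerivAt (fun x => fieldDiagonal a i₀ x i)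
      (∑ j, a i j • (Real.exp (extendCoord i₀ j x - extendCoord i₀ i x) •
        (extendCoord i₀ j - extendCoord i₀ i))) x := by
    simp only [fieldDiagonal, tiltedWeight, ← extendCoord_apply]
    refine HasFDerivAt.fun_sum fun j _ => ?_
    exact (((extendCoord i₀ j).hasFDerivAt.sub (extendCoord i₀ i).hasFDerivAt).exp).const_mul _
  convert! h using 1
  ext z
  simp only [extendCoord_apply, _root_.sum_apply, _root_.smul_apply,
    _root_.sub_apply, ContinuousLinearMap.comp_apply, _root_.neg_apply,
    ContinuousLinearMap.proj_apply, LinearMap.coe_toContinuousLinearMap', Pi.neg_apply,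
    Matrix.toLin'_apply, smul_eq_mul, extendByZero_coe]
  have h1 : ∀ j, a i j * (Real.exp (extendByZero i₀ x j - x i) *
      (extendByZero i₀ z j - z i)) = tiltedWeight a (extendByZero i₀ x) i j * extendByZero i₀ z j -
        tiltedWeight a (extendByZero i₀ x) i j * z i := by
    intro j
    simp only [tiltedWeight, extendByZero_coe]; ring
  simp only [h1, Finset.sum_sub_distrib, ← Finset.sum_mul]
  rw [sum_split_off (fun j => tiltedWeight a (extendByZero i₀ x) i j * extendByZero i₀ z j) i₀]
  simp only [Matrix.mulVec, dotProduct, reducedLaplacian, Matrix.of_apply, sub_mul,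
    Finset.sum_sub_distrib]
  simp

theorem fieldDiagonal_injective {a : V → V → ℝ} {i₀ : V}
    (hdet : ∀ x, (fieldOperator a i₀ x).det ≠ 0) : Function.Injective (fieldDiagonal a i₀) := by
  intro x y h
  have hH : fieldOperator a i₀ x = fieldOperator a i₀ y := by simp only [fieldOperator, h]
  have h1 := fieldOperator_mulVec_exp a i₀ x
  rw [← fieldOperator_mulVec_exp a i₀ y, hH] at h1
  have h2 := (Matrix.mulVec_injective_iff_isUnit.2
    ((Matrix.isUnit_iff_isUnit_det _).2 (isUnit_iff_ne_zero.2 (hdet y)))) h1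
  funext i
  exact Real.exp_injective (congrFun h2 i)

theorem isSymm_offDiagonal {V : Type*} {a : V → V → ℝ} (ha : ∀ i j, a i j = a j i) (i₀ : V) :
    (offDiagonal a i₀).IsSymm :=
  Matrix.IsSymm.ext fun i j => by simp [offDiagonal, ha i j]

/-- Ground state transform: writing `f = e^u g` with `g = 0` at the root, the quadratic form becomes
half of `∑ a_{i,j} e^{u_i + u_j} (g_i - g_j)²`. -/
theorem posSemidef_fieldOperator {a : V → V → ℝ} (ha : ∀ i j, a i j = a j i)
    (ha0 : ∀ i j, 0 ≤ a i j) (i₀ : V) (x : {i : V // i ≠ i₀} → ℝ) :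
    (fieldOperator a i₀ x).PosSemidef := by
  refine Matrix.PosSemidef.of_dotProduct_mulVec_nonneg ?_ fun f => ?_
  · have : (fieldOperator a i₀ x).IsSymm :=
      (isSymm_offDiagonal ha i₀).add (Matrix.isSymm_diagonal _)
    rwa [Matrix.IsHermitian, Matrix.conjTranspose_eq_transpose_of_trivial]
  set u := extendByZero i₀ x with hu
  set g : V → ℝ := extendByZero i₀ fun i => f i * Real.exp (-x i) with hg
  set b : V → V → ℝ := fun i j => a i j * Real.exp (u i + u j) with hb
  have hb0 : ∀ i j, 0 ≤ b i j := fun i j => mul_nonneg (ha0 i j) (Real.exp_pos _).le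
  have hbs : ∀ i j, b i j = b j i := fun i j => by simp only [hb, ha i j, add_comm]
  have h1 : ∑ i, ∑ j, b i j * (g i * g j) ≤ ∑ i, ∑ j, b i j * g i ^ 2 := by
    have h2 : ∑ i, ∑ j, b i j * g j ^ 2 = ∑ i, ∑ j, b i j * g i ^ 2 := by
      rw [Finset.sum_comm]
      exact Finset.sum_congr rfl fun i _ => Finset.sum_congr rfl fun j _ => by rw [hbs]
    have h3 : ∑ i, ∑ j, 2 * (b i j * (g i * g j)) ≤
        ∑ i, ∑ j, (b i j * g i ^ 2 + b i j * g j ^ 2) := by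
      refine Finset.sum_le_sum fun i _ => Finset.sum_le_sum fun j _ => ?_
      nlinarith [mul_nonneg (hb0 i j) (sq_nonneg (g i - g j))]
    simp only [Finset.sum_add_distrib, ← Finset.mul_sum] at h3
    linarith
  have hgf : ∀ i : {i : V // i ≠ i₀}, g i = f i * Real.exp (-x i) := fun i => by
    rw [hg, extendByZero_coe]
  have hg0 : g i₀ = 0 := by rw [hg, extendByZero_root]
  have hux : ∀ i : {i : V // i ≠ i₀}, u i = x i := fun i => by rw [hu, extendByZero_coe]
  have e1 : ∑ i, ∑ j, b i j * g i ^ 2 =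
      ∑ i : {i : V // i ≠ i₀}, f i * (fieldDiagonal a i₀ x i * f i) := by
    rw [sum_split_off _ i₀]
    simp only [hg0, ne_eq, OfNat.ofNat_ne_zero, not_false_eq_true, zero_pow, mul_zero,
      Finset.sum_const_zero, add_zero]
    refine Finset.sum_congr rfl fun i _ => ?_
    simp only [fieldDiagonal, Finset.sum_mul, Finset.mul_sum]
    refine Finset.sum_congr rfl fun j _ => ?_
    rw [hgf]
    simp only [hb, tiltedWeight, ← hu, hux]
    rw [Real.exp_neg, sub_eq_add_neg, Real.exp_add, Real.exp_add, Real.exp_neg]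
    field_simp
  have e2 : ∑ i, ∑ j, b i j * (g i * g j) =
      ∑ i : {i : V // i ≠ i₀}, f i * ∑ j : {i : V // i ≠ i₀}, a i j * f j := by
    rw [sum_split_off _ i₀]
    simp only [hg0, zero_mul, mul_zero, Finset.sum_const_zero, add_zero]
    refine Finset.sum_congr rfl fun i _ => ?_
    rw [sum_split_off _ i₀, hg0, Finset.mul_sum, mul_zero, mul_zero, add_zero]
    refine Finset.sum_congr rfl fun j _ => ?_
    rw [hgf, hgf]
    simp only [hb, hux]
    rw [Real.exp_neg, Real.exp_neg, Real.exp_add]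
    field_simp
  rw [e1, e2] at h1
  simp only [star_trivial, dotProduct, fieldOperator_mulVec, mul_sub, Finset.sum_sub_distrib]
  linarith

/-- Edges away from the root sum to `⟨1, H 1⟩` up to boundary terms, and edges at the root produce
`⟨η, e^u⟩ = ⟨η, H⁻¹ η⟩`. -/
theorem energy_eq {a : V → V → ℝ} (ha : ∀ i j, a i j = a j i) (hd : ∀ i, a i i = 0) (i₀ : V)
    (x : {i : V // i ≠ i₀} → ℝ) (hdet : (fieldOperator a i₀ x).det ≠ 0) :
    ∑ i, ∑ j, a i j * (Real.exp (extendByZero i₀ x j - extendByZero i₀ x i) - 1) =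
      (1 : {i : V // i ≠ i₀} → ℝ) ⬝ᵥ (fieldOperator a i₀ x).mulVec 1 +
        (fun i : {i : V // i ≠ i₀} => a i i₀) ⬝ᵥ
          (fieldOperator a i₀ x)⁻¹.mulVec (fun i : {i : V // i ≠ i₀} => a i i₀) -
        2 * ∑ i : {i : V // i ≠ i₀}, a i i₀ := by
  have hinv : (fieldOperator a i₀ x)⁻¹.mulVec (fun i : {i : V // i ≠ i₀} => a i i₀) =
      fun i => Real.exp (x i) := by
    rw [← fieldOperator_mulVec_exp a i₀ x, Matrix.mulVec_mulVec,
      Matrix.nonsing_inv_mul _ (isUnit_iff_ne_zero.2 hdet), Matrix.one_mulVec]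
  rw [hinv]
  have e1 : ∑ i, ∑ j, a i j * (Real.exp (extendByZero i₀ x j - extendByZero i₀ x i) - 1) =
      ∑ i, ∑ j, tiltedWeight a (extendByZero i₀ x) i j - ∑ i, ∑ j, a i j := by
    simp only [← Finset.sum_sub_distrib, tiltedWeight, mul_sub, mul_one]
  have e2 : ∑ i, ∑ j, tiltedWeight a (extendByZero i₀ x) i j =
      ∑ i, fieldDiagonal a i₀ x i +
        ∑ i : {i : V // i ≠ i₀}, a i i₀ * Real.exp (x i) := by
    rw [sum_split_off _ i₀, sum_split_off (fun j => tiltedWeight a (extendByZero i₀ x) i₀ j) i₀]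
    simp [fieldDiagonal, tiltedWeight, hd, ha i₀]
  have e3 : ∑ i, ∑ j, a i j = ∑ i : {i : V // i ≠ i₀}, ∑ j : {i : V // i ≠ i₀}, a i j +
      2 * ∑ i : {i : V // i ≠ i₀}, a i i₀ := by
    rw [sum_split_off _ i₀, sum_split_off (fun j => a i₀ j) i₀]
    have : ∀ i : {i : V // i ≠ i₀}, ∑ j, a i j = ∑ j : {i : V // i ≠ i₀}, a i j + a i i₀ :=
      fun i => sum_split_off _ i₀
    simp only [this, Finset.sum_add_distrib, hd, ha i₀]
    ring
  rw [e1, e2, e3]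
  simp only [dotProduct, fieldOperator_mulVec, Pi.one_apply, mul_one, one_mul,
    Finset.sum_sub_distrib]
  ring

end Field

/-! ### The mixing field has mass at most one -/

section Weights
variable {V : Type*}

open Classical in
/-- The conductances, as a function on ordered pairs of vertices. -/
noncomputable def edgeWeight (G : SimpleGraph V) (W : Sym2 V → ℝ) (i j : V) : ℝ :=
  if G.Adj i j then W s(i, j) else 0

theorem edgeWeight_comm (G : SimpleGraph V) (W : Sym2 V → ℝ) (i j : V) :
    edgeWeight G W i j = edgeWeight G W j i := by
  rw [edgeWeight, edgeWeight, Sym2.eq_swap]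
  classical exact if_congr (G.adj_comm i j) rfl rfl

theorem edgeWeight_self (G : SimpleGraph V) (W : Sym2 V → ℝ) (i : V) : edgeWeight G W i i = 0 := by
  simp [edgeWeight]

theorem edgeWeight_nonneg {G : SimpleGraph V} {W : Sym2 V → ℝ} (hW : ∀ e ∈ G.edgeSet, 0 < W e)
    (i j : V) : 0 ≤ edgeWeight G W i j := by
  unfold edgeWeight
  split_ifs with h
  · exact (hW _ h).le
  · exact le_rfl

end Weights

section Mass
variable {V : Type*} [Fintype V]

theorem edgeEnergy_eq (G : SimpleGraph V) (W : Sym2 V → ℝ) (u : V → ℝ) :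
    edgeEnergy G W u = ∑ i, ∑ j, edgeWeight G W i j * (Real.exp (u j - u i) - 1) := by
  simp only [edgeEnergy, edgeWeight, ite_mul, zero_mul]

open Classical in
theorem treeSum_eq (G : SimpleGraph V) (W : Sym2 V → ℝ) (i₀ : V) (u : V → ℝ) :
    treeSum G W i₀ u = ∑ T : Finset (V × V) with IsSpanningTreeTowards G i₀ T,
      ∏ e ∈ T, tiltedWeight (edgeWeight G W) u e.1 e.2 := by
  refine Finset.sum_congr rfl fun T hT => Finset.prod_congr rfl fun e he => ?_
  rw [tiltedWeight, edgeWeight, if_pos ((Finset.mem_filter.1 hT).2.1 e he)]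

theorem treeSum_nonneg {G : SimpleGraph V} {W : Sym2 V → ℝ} (hW : ∀ e ∈ G.edgeSet, 0 < W e)
    (i₀ : V) (u : V → ℝ) : 0 ≤ treeSum G W i₀ u := by
  classical
  rw [treeSum_eq]
  exact Finset.sum_nonneg fun T _ => Finset.prod_nonneg fun e _ =>
    mul_nonneg (edgeWeight_nonneg hW _ _) (Real.exp_pos _).le

theorem treeSum_pos {G : SimpleGraph V} {W : Sym2 V → ℝ} (hW : ∀ e ∈ G.edgeSet, 0 < W e)
    {i₀ : V} (hT : ∃ T, IsSpanningTreeTowards G i₀ T) (u : V → ℝ) : 0 < treeSum G W i₀ u := by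
  classical
  obtain ⟨T, hT⟩ := hT
  refine Finset.sum_pos (fun T hT => Finset.prod_pos fun e he => ?_) ⟨T, by simpa using hT⟩
  exact mul_pos (hW _ ((Finset.mem_filter.1 hT).2.1 e he)) (Real.exp_pos _)

theorem treeSum_eq_zero {G : SimpleGraph V} (W : Sym2 V → ℝ)
    {i₀ : V} (hT : ¬ ∃ T, IsSpanningTreeTowards G i₀ T) (u : V → ℝ) : treeSum G W i₀ u = 0 := by
  classical
  refine Finset.sum_eq_zero fun T hT' => ?_
  exact absurd ⟨T, (Finset.mem_filter.1 hT').2⟩ hT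

variable [DecidableEq V]

theorem treeSum_le_det {G : SimpleGraph V} {W : Sym2 V → ℝ} (hW : ∀ e ∈ G.edgeSet, 0 < W e)
    (i₀ : V) (x : {i : V // i ≠ i₀} → ℝ) :
    treeSum G W i₀ (extendByZero i₀ x) ≤ (fieldOperator (edgeWeight G W) i₀ x).det := by
  classical
  rw [← det_reducedLaplacian_eq, treeSum_eq]
  exact sum_spanningTree_le_det G i₀ _ fun i j =>
    mul_nonneg (edgeWeight_nonneg hW _ _) (Real.exp_pos _).le

theorem card_ne_root (i₀ : V) : Fintype.card {i : V // i ≠ i₀} = Fintype.card V - 1 := by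
  rw [Fintype.card_subtype_compl, Fintype.card_subtype_eq]

theorem mixingDensity_le {G : SimpleGraph V} {W : Sym2 V → ℝ} (hW : ∀ e ∈ G.edgeSet, 0 < W e)
    {i₀ : V} (hT : ∃ T, IsSpanningTreeTowards G i₀ T) (x : {i : V // i ≠ i₀} → ℝ) :
    ENNReal.ofReal (mixingDensity G W i₀ (extendByZero i₀ x)) ≤
      ENNReal.ofReal ((√(2 * Real.pi) ^ Fintype.card {i : V // i ≠ i₀})⁻¹ *
        Real.exp (∑ i : {i : V // i ≠ i₀}, edgeWeight G W i i₀)) *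
      (ENNReal.ofReal (fieldOperator (edgeWeight G W) i₀ x).det *
        restrictedDensity (fieldOperator (edgeWeight G W) i₀ x)
          fun i : {i : V // i ≠ i₀} => edgeWeight G W i i₀) := by
  have hle := treeSum_le_det hW i₀ x
  have hpos := (treeSum_pos hW hT (extendByZero i₀ x)).trans_le hle
  have hPD := (posSemidef_fieldOperator (edgeWeight_comm G W) (edgeWeight_nonneg hW) i₀
    x).posDef_iff_det_ne_zero.2 hpos.ne'
  rw [restrictedDensity, if_pos hPD.principalMinorsPos, ← ENNReal.ofReal_mul hpos.le,
    ← ENNReal.ofReal_mul (by positivity)]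
  refine ENNReal.ofReal_le_ofReal ?_
  rw [mixingDensity, edgeEnergy_eq,
    energy_eq (edgeWeight_comm G W) (edgeWeight_self G W) i₀ x hpos.ne', operatorDensity,
    card_ne_root]
  set H := fieldOperator (edgeWeight G W) i₀ x
  set p := (1 : {i : V // i ≠ i₀} → ℝ) ⬝ᵥ H.mulVec 1
  set r := (fun i : {i : V // i ≠ i₀} => edgeWeight G W i i₀) ⬝ᵥ
    H⁻¹.mulVec (fun i : {i : V // i ≠ i₀} => edgeWeight G W i i₀)
  set E := ∑ i : {i : V // i ≠ i₀}, edgeWeight G W i i₀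
  have e1 : Real.exp (-(1 / 2) * (p + r - 2 * E)) = Real.exp E * Real.exp (-(p + r) / 2) := by
    rw [← Real.exp_add]; congr 1; ring
  -- The Jacobian `det H` turns the `1 / √(det H)` of the operator density into the `√(det H)` that
  -- dominates the square root of the tree sum.
  have e2 : H.det * (Real.exp (-(p + r) / 2) / √H.det) = Real.exp (-(p + r) / 2) * √H.det := by
    have := Real.mul_self_sqrt hpos.le
    have h0 := Real.sqrt_pos.2 hpos
    field_simp
    rw [sq, this]
  rw [e1, e2, one_div, mul_assoc, mul_assoc, mul_assoc]
  gcongr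

open MeasureTheory in
-- Change of variables by an injective map; its range need not be determined for an upper bound.
theorem lintegral_fieldDiagonal_le {a : V → V → ℝ} {i₀ : V}
    (hdet : ∀ x, 0 < (fieldOperator a i₀ x).det) (g : ({i : V // i ≠ i₀} → ℝ) → ENNReal) :
    ∫⁻ x, ENNReal.ofReal (fieldOperator a i₀ x).det * g (fieldDiagonal a i₀ x) ≤ ∫⁻ d, g d := by
  have h := lintegral_image_eq_lintegral_abs_det_fderiv_mul
    (volume : Measure ({i : V // i ≠ i₀} → ℝ)) MeasurableSet.univ
    (fun x _ => (hasFDerivAt_fieldDiagonal a i₀ x).hasFDerivWithinAt)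
    (fieldDiagonal_injective fun x => (hdet x).ne').injOn g
  simp only [Measure.restrict_univ] at h
  have hd : ∀ x, |(-(Matrix.toLin' (reducedLaplacian
      (tiltedWeight a (extendByZero i₀ x)) i₀)).toContinuousLinearMap).det| =
      (fieldOperator a i₀ x).det := by
    intro x
    rw [← det_reducedLaplacian_eq, ContinuousLinearMap.det, ContinuousLinearMap.toLinearMap_neg,
      ← neg_one_smul ℝ, LinearMap.det_smul, LinearMap.coe_toContinuousLinearMap,
      LinearMap.det_toLin', abs_mul, abs_pow, abs_neg, abs_one, one_pow, one_mul, abs_of_pos]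
    rw [det_reducedLaplacian_eq]
    exact hdet x
  simp only [hd] at h
  rw [← h]
  exact setLIntegral_le_lintegral _ _

theorem mixing_constant {ι : Type*} [Fintype ι] (η : ι → ℝ) :
    ENNReal.ofReal ((√(2 * Real.pi) ^ Fintype.card ι)⁻¹ * Real.exp (∑ i, η i)) *
      ENNReal.ofReal (√(2 * Real.pi) ^ Fintype.card ι * Real.exp (-∑ i, η i)) = 1 := by
  have h : 0 < √(2 * Real.pi) := Real.sqrt_pos.2 (by positivity)
  rw [← ENNReal.ofReal_mul (by positivity), Real.exp_neg, ← ENNReal.ofReal_one]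
  congr 1
  field_simp

open MeasureTheory in
theorem lintegral_mixingDensity_le_one {G : SimpleGraph V} {W : Sym2 V → ℝ}
    (hW : ∀ e ∈ G.edgeSet, 0 < W e) (i₀ : V) :
    ∫⁻ x, ENNReal.ofReal (mixingDensity G W i₀ (extendByZero i₀ x)) ≤ 1 := by
  -- Without a spanning tree the density vanishes identically, so connectedness never has to be
  -- established.
  by_cases hT : ∃ T, IsSpanningTreeTowards G i₀ T
  · have hdet : ∀ x, 0 < (fieldOperator (edgeWeight G W) i₀ x).det := fun x =>
      (treeSum_pos hW hT _).trans_le (treeSum_le_det hW i₀ x)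
    refine (lintegral_mono fun x => mixingDensity_le hW hT x).trans ?_
    rw [lintegral_const_mul' _ _ ENNReal.ofReal_ne_top,
      ← mixing_constant fun i : {i : V // i ≠ i₀} => edgeWeight G W i i₀]
    gcongr
    refine (lintegral_fieldDiagonal_le hdet fun d => restrictedDensity
      (offDiagonal (edgeWeight G W) i₀ + Matrix.diagonal d) _).trans ?_
    exact lintegral_restrictedDensity_le _ (isSymm_offDiagonal (edgeWeight_comm G W) i₀) _
  · simp [mixingDensity, treeSum_eq_zero W hT]

open MeasureTheory in
theorem lintegral_exp_mul_mixingDensity_le_one {G : SimpleGraph V} {W : Sym2 V → ℝ}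
    (hW : ∀ e ∈ G.edgeSet, 0 < W e) (i₀ y : V) :
    ∫⁻ x, ENNReal.ofReal (Real.exp (extendByZero i₀ x y)) *
      ENNReal.ofReal (mixingDensity G W i₀ (extendByZero i₀ x)) ≤ 1 := by
  by_cases hy : y = i₀
  · subst hy
    simpa using lintegral_mixingDensity_le_one hW y
  by_cases hT : ∃ T, IsSpanningTreeTowards G i₀ T
  · have hdet : ∀ x, 0 < (fieldOperator (edgeWeight G W) i₀ x).det := fun x =>
      (treeSum_pos hW hT _).trans_le (treeSum_le_det hW i₀ x)
    set η := fun i : {i : V // i ≠ i₀} => edgeWeight G W i i₀ with hη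
    have hinv : ∀ x, extendByZero i₀ x y = x ⟨y, hy⟩ ∧ Real.exp (x ⟨y, hy⟩) =
        ((fieldOperator (edgeWeight G W) i₀ x)⁻¹.mulVec η) ⟨y, hy⟩ := by
      refine fun x => ⟨extendByZero_coe i₀ x ⟨y, hy⟩, ?_⟩
      rw [hη, ← fieldOperator_mulVec_exp (edgeWeight G W) i₀ x, Matrix.mulVec_mulVec,
        Matrix.nonsing_inv_mul _ (isUnit_iff_ne_zero.2 (hdet x).ne'), Matrix.one_mulVec]
    have hle : ∀ x, ENNReal.ofReal (Real.exp (extendByZero i₀ x y)) *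
        ENNReal.ofReal (mixingDensity G W i₀ (extendByZero i₀ x)) ≤
        ENNReal.ofReal ((√(2 * Real.pi) ^ Fintype.card {i : V // i ≠ i₀})⁻¹ *
          Real.exp (∑ i, η i)) * (ENNReal.ofReal (fieldOperator (edgeWeight G W) i₀ x).det *
          (ENNReal.ofReal (((fieldOperator (edgeWeight G W) i₀ x)⁻¹.mulVec η) ⟨y, hy⟩) *
            restrictedDensity (fieldOperator (edgeWeight G W) i₀ x) η)) := by
      intro x
      rw [(hinv x).1, (hinv x).2]
      refine (mul_le_mul_right (mixingDensity_le hW hT x) _).trans (le_of_eq ?_)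
      ring
    refine (lintegral_mono hle).trans ?_
    rw [lintegral_const_mul' _ _ ENNReal.ofReal_ne_top, ← mixing_constant η]
    gcongr
    refine (lintegral_fieldDiagonal_le hdet fun d => ENNReal.ofReal
      (((offDiagonal (edgeWeight G W) i₀ + Matrix.diagonal d)⁻¹.mulVec η) ⟨y, hy⟩) *
        restrictedDensity (offDiagonal (edgeWeight G W) i₀ + Matrix.diagonal d) η).trans ?_
    exact lintegral_inv_mul_restrictedDensity_le _
      (isSymm_offDiagonal (edgeWeight_comm G W) i₀) _ _
  · simp [mixingDensity, treeSum_eq_zero W hT]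

end Mass

/-! ### Fractional moments by deformation of the field -/

section Deformation
variable {V : Type*} [Fintype V]

theorem continuous_treeSum (G : SimpleGraph V) (W : Sym2 V → ℝ) (i₀ : V) :
    Continuous (treeSum G W i₀) := by
  unfold treeSum
  fun_prop

theorem continuous_edgeEnergy (G : SimpleGraph V) (W : Sym2 V → ℝ) :
    Continuous (edgeEnergy G W) := by
  simp only [funext fun u => edgeEnergy_eq G W u]
  fun_prop

theorem continuous_mixingDensity (G : SimpleGraph V) (W : Sym2 V → ℝ) (i₀ : V) :
    Continuous (mixingDensity G W i₀) := by
  unfold mixingDensity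
  have h1 := continuous_treeSum G W i₀
  have h2 := continuous_edgeEnergy G W
  fun_prop

theorem mixingDensity_nonneg (G : SimpleGraph V) (W : Sym2 V → ℝ) (i₀ : V) (u : V → ℝ) :
    0 ≤ mixingDensity G W i₀ u := by
  unfold mixingDensity; positivity

/-- Each tree contributes the exponential of an affine function of `u`, and Hölder's inequality
makes a sum of such terms log-convex. -/
theorem treeSum_convexComb_le {G : SimpleGraph V} {W : Sym2 V → ℝ} (hW : ∀ e ∈ G.edgeSet, 0 < W e)
    (i₀ : V) {s t : ℝ} (hs : 0 < s) (ht : 0 < t) (hst : s + t = 1) (u₁ u₂ : V → ℝ) :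
    treeSum G W i₀ (fun i => s * u₁ i + t * u₂ i) ≤
      treeSum G W i₀ u₁ ^ s * treeSum G W i₀ u₂ ^ t := by
  classical
  set P : (V → ℝ) → Finset (V × V) → ℝ := fun u T => ∏ e ∈ T, W s(e.1, e.2) * Real.exp (u e.2 - u e.1)
    with hP
  have hpos : ∀ u, ∀ T ∈ Finset.univ.filter (IsSpanningTreeTowards G i₀), 0 < P u T := by
    intro u T hT
    exact Finset.prod_pos fun e he =>
      mul_pos (hW _ ((Finset.mem_filter.1 hT).2.1 e he)) (Real.exp_pos _)
  have hconj : (1 / s).HolderConjugate (1 / t) := by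
    rw [Real.holderConjugate_iff]
    refine ⟨by rw [lt_div_iff₀ hs]; linarith, by simpa using hst⟩
  have h := Real.inner_le_Lp_mul_Lq_of_nonneg
    (Finset.univ.filter (IsSpanningTreeTowards G i₀)) hconj
    (f := fun T => P u₁ T ^ s) (g := fun T => P u₂ T ^ t)
    (fun T hT => (Real.rpow_pos_of_pos (hpos u₁ T hT) _).le)
    (fun T hT => (Real.rpow_pos_of_pos (hpos u₂ T hT) _).le)
  have e1 : ∑ T with IsSpanningTreeTowards G i₀ T, (P u₁ T ^ s) ^ (1 / s) = treeSum G W i₀ u₁ :=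
    Finset.sum_congr rfl fun T hT => by
      rw [← Real.rpow_mul (hpos u₁ T hT).le, mul_one_div_cancel hs.ne', Real.rpow_one]
  have e2 : ∑ T with IsSpanningTreeTowards G i₀ T, (P u₂ T ^ t) ^ (1 / t) = treeSum G W i₀ u₂ :=
    Finset.sum_congr rfl fun T hT => by
      rw [← Real.rpow_mul (hpos u₂ T hT).le, mul_one_div_cancel ht.ne', Real.rpow_one]
  have e3 : ∑ T with IsSpanningTreeTowards G i₀ T, P u₁ T ^ s * P u₂ T ^ t =
      treeSum G W i₀ (fun i => s * u₁ i + t * u₂ i) := by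
    refine Finset.sum_congr rfl fun T hT => ?_
    have hWT : ∀ e ∈ T, 0 < W s(e.1, e.2) := fun e he => hW _ ((Finset.mem_filter.1 hT).2.1 e he)
    rw [← Real.finsetProd_rpow, ← Real.finsetProd_rpow, ← Finset.prod_mul_distrib]
    · refine Finset.prod_congr rfl fun e he => ?_
      have h0 := hWT e he
      rw [Real.mul_rpow h0.le (Real.exp_pos _).le, Real.mul_rpow h0.le (Real.exp_pos _).le,
        mul_mul_mul_comm, ← Real.rpow_add h0, hst, Real.rpow_one, ← Real.exp_mul, ← Real.exp_mul,
        ← Real.exp_add]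
      congr 2; ring
    · exact fun e he => mul_nonneg (hWT e he).le (Real.exp_pos _).le
    · exact fun e he => mul_nonneg (hWT e he).le (Real.exp_pos _).le
  rw [e1, e2, e3, one_div_one_div, one_div_one_div] at h
  exact h

theorem inv_one_sub_le_exp {r : ℝ} (h0 : 0 ≤ r) (h1 : r ≤ 1 / 2) :
    1 ≤ (1 - r) * Real.exp (2 * r) := by
  have := Real.add_one_le_exp (2 * r)
  nlinarith

open Classical in
-- Lowering a conductance by the factor `1 - r ≥ exp (-2 r)` costs at most `exp (2 r)` per edge of a
-- tree. A tree uses each directed edge at most once, so the sum over all directed edges bounds the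
-- cost uniformly in the tree.
theorem treeSum_le_reduced {G : SimpleGraph V} {W : Sym2 V → ℝ} (hW : ∀ e ∈ G.edgeSet, 0 < W e)
    (i₀ : V) {r : Sym2 V → ℝ} (hr0 : ∀ e, 0 ≤ r e) (hr1 : ∀ e ∈ G.edgeSet, r e ≤ 1 / 2)
    (u : V → ℝ) :
    treeSum G W i₀ u ≤ treeSum G (fun e => W e * (1 - r e)) i₀ u *
      Real.exp (2 * ∑ i, ∑ j, if G.Adj i j then r s(i, j) else 0) := by
  rw [treeSum, treeSum, Finset.sum_mul]
  refine Finset.sum_le_sum fun T hT => ?_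
  have hadj := (Finset.mem_filter.1 hT).2.1
  have h1 : ∏ e ∈ T, W s(e.1, e.2) * Real.exp (u e.2 - u e.1) ≤
      ∏ e ∈ T, (W s(e.1, e.2) * (1 - r s(e.1, e.2)) * Real.exp (u e.2 - u e.1)) *
        Real.exp (2 * r s(e.1, e.2)) := by
    refine Finset.prod_le_prod (fun e he => mul_nonneg (hW _ (hadj e he)).le (Real.exp_pos _).le)
      fun e he => ?_
    have h2 := inv_one_sub_le_exp (hr0 s(e.1, e.2)) (hr1 _ (hadj e he))
    have h3 := mul_pos (hW s(e.1, e.2) (hadj e he)) (Real.exp_pos (u e.2 - u e.1))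
    calc _ ≤ (W s(e.1, e.2) * Real.exp (u e.2 - u e.1)) *
          ((1 - r s(e.1, e.2)) * Real.exp (2 * r s(e.1, e.2))) := le_mul_of_one_le_right h3.le h2
      _ = _ := by ring
  refine h1.trans ?_
  rw [Finset.prod_mul_distrib, ← Real.exp_sum]
  refine mul_le_mul_of_nonneg_left (Real.exp_le_exp.2 ?_) (Finset.prod_nonneg fun e he => ?_)
  · rw [← Finset.mul_sum]
    refine mul_le_mul_of_nonneg_left ?_ (by norm_num)
    rw [← Fintype.sum_prod_type' (f := fun i j => if G.Adj i j then r s(i, j) else 0)]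
    calc ∑ e ∈ T, r s(e.1, e.2) = ∑ e ∈ T, if G.Adj e.1 e.2 then r s(e.1, e.2) else 0 :=
          Finset.sum_congr rfl fun e he => by rw [if_pos (hadj e he)]
      _ ≤ _ := Finset.sum_le_sum_of_subset_of_nonneg (Finset.subset_univ _) fun e _ _ => by
          split_ifs
          exacts [hr0 _, le_rfl]
  · have := hr1 s(e.1, e.2) (hadj e he)
    exact mul_nonneg (mul_nonneg (hW _ (hadj e he)).le (by linarith)) (Real.exp_pos _).le

/-- For the original conductances, convexity of `exp` gives the opposite inequality. After factoring
out the exponential of the gradient of `u - (s/t) v`, the claim on one edge is `t (1 - r) + s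
e^{z/t} ≤ e^{s z/t}` with `z = v j - v i`, which is `hf` times `t`. The additive `-1` terms leave
the correction `t W r`. -/
theorem edgeEnergy_deformation_le {G : SimpleGraph V} {W : Sym2 V → ℝ}
    (hW : ∀ e ∈ G.edgeSet, 0 < W e) {s t : ℝ} (ht : 0 < t) (hst : s + t = 1)
    (v : V → ℝ) {r : Sym2 V → ℝ}
    (hf : ∀ i j, G.Adj i j → 1 - r s(i, j) ≤
      1 / t * Real.exp (s / t * (v j - v i)) - s / t * Real.exp ((v j - v i) / t))
    (u : V → ℝ) :
    s * edgeEnergy G W (fun i => u i + v i) +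
      t * edgeEnergy G (fun e => W e * (1 - r e)) (fun i => u i - s / t * v i) ≤
    edgeEnergy G W u + t * ∑ i, ∑ j, edgeWeight G W i j * r s(i, j) := by
  simp only [edgeEnergy, edgeWeight, Finset.mul_sum, ← Finset.sum_add_distrib]
  refine Finset.sum_le_sum fun i _ => Finset.sum_le_sum fun j _ => ?_
  split_ifs with h
  · have hw := hW s(i, j) h
    have h1 := hf i j h
    set z := v j - v i
    set w := W s(i, j)
    set ρ := r s(i, j)
    have e1 : Real.exp (u j + v j - (u i + v i)) =
        Real.exp (u j - s / t * v j - (u i - s / t * v i)) * Real.exp (z / t) := by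
      rw [← Real.exp_add]; congr 1
      have : s = 1 - t := by linarith
      subst this
      field_simp; ring
    have e2 : Real.exp (u j - u i) =
        Real.exp (u j - s / t * v j - (u i - s / t * v i)) * Real.exp (s / t * z) := by
      rw [← Real.exp_add]; congr 1; ring
    rw [e1, e2]
    set X := Real.exp (u j - s / t * v j - (u i - s / t * v i))
    set A := Real.exp (z / t)
    set B := Real.exp (s / t * z)
    have hX : 0 < X := Real.exp_pos _
    have h2 : t * (1 - ρ) + s * A ≤ B := by
      have := mul_le_mul_of_nonneg_left h1 ht.le
      have e : t * (1 / t * B - s / t * A) = B - s * A := by field_simp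
      linarith
    have h3 := mul_le_mul_of_nonneg_left h2 (mul_pos hw hX).le
    have : s = 1 - t := by linarith
    subst this
    nlinarith
  · simp

open Classical in
/-- The cost of the deformation with relative reduction `r` of the conductances. -/
noncomputable def deformationCost (G : SimpleGraph V) (W r : Sym2 V → ℝ) : ℝ :=
  ∑ i, ∑ j, if G.Adj i j then (W s(i, j) / 2 + 1) * r s(i, j) else 0

theorem deformationCost_eq (G : SimpleGraph V) (W r : Sym2 V → ℝ) :
    deformationCost G W r = 1 / 2 * ∑ i, ∑ j, edgeWeight G W i j * r s(i, j) +
      open Classical in ∑ i, ∑ j, if G.Adj i j then r s(i, j) else 0 := by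
  simp only [deformationCost, edgeWeight, Finset.mul_sum, ← Finset.sum_add_distrib]
  refine Finset.sum_congr rfl fun i _ => Finset.sum_congr rfl fun j _ => ?_
  split_ifs <;> ring

/-- In the cost, `W r / 2` comes from the energy, and `r` from the square root of the factor `exp (2
r)` lost in the tree sum. -/
theorem mixingDensity_deformation_le {G : SimpleGraph V} {W : Sym2 V → ℝ}
    (hW : ∀ e ∈ G.edgeSet, 0 < W e) (i₀ : V) {s t : ℝ} (hs : 0 < s) (ht : 0 < t)
    (hst : s + t = 1) (v : V → ℝ) {r : Sym2 V → ℝ} (hr0 : ∀ e, 0 ≤ r e)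
    (hr1 : ∀ e ∈ G.edgeSet, r e ≤ 1 / 2)
    (hf : ∀ i j, G.Adj i j → 1 - r s(i, j) ≤
      1 / t * Real.exp (s / t * (v j - v i)) - s / t * Real.exp ((v j - v i) / t))
    (u : V → ℝ) :
    mixingDensity G W i₀ u ≤ mixingDensity G W i₀ (fun i => u i + v i) ^ s *
      (Real.exp (deformationCost G W r) *
        mixingDensity G (fun e => W e * (1 - r e)) i₀ (fun i => u i - s / t * v i)) ^ t := by
  classical
  have hE := edgeEnergy_deformation_le hW ht hst v hf u
  have hD := treeSum_convexComb_le hW i₀ hs ht hst (fun i => u i + v i)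
    (fun i => u i - s / t * v i)
  have hu : (fun i => s * (u i + v i) + t * (u i - s / t * v i)) = u := by
    funext i
    have : s = 1 - t := by linarith
    subst this
    field_simp; ring
  rw [hu] at hD
  have hR := treeSum_le_reduced hW i₀ hr0 hr1 (fun i => u i - s / t * v i)
  have hW' : ∀ e ∈ G.edgeSet, 0 < W e * (1 - r e) := fun e he =>
    mul_pos (hW e he) (by linarith [hr1 e he])
  have hD0 := treeSum_nonneg hW i₀ u
  have hD1 := treeSum_nonneg hW i₀ (fun i => u i + v i)
  have hD2 := treeSum_nonneg hW i₀ (fun i => u i - s / t * v i)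
  have hD3 := treeSum_nonneg hW' i₀ (fun i => u i - s / t * v i)
  rw [deformationCost_eq]
  unfold mixingDensity
  set C := 1 / √(2 * Real.pi) ^ (Fintype.card V - 1)
  have hC : 0 < C := by positivity
  set E₀ := edgeEnergy G W u
  set E₁ := edgeEnergy G W fun i => u i + v i
  set E₂ := edgeEnergy G (fun e => W e * (1 - r e)) fun i => u i - s / t * v i
  set D₀ := treeSum G W i₀ u
  set D₁ := treeSum G W i₀ fun i => u i + v i
  set D₂ := treeSum G W i₀ fun i => u i - s / t * v i
  set D₃ := treeSum G (fun e => W e * (1 - r e)) i₀ fun i => u i - s / t * v i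
  set R := ∑ i, ∑ j, if G.Adj i j then r s(i, j) else 0
  set Q := ∑ i, ∑ j, edgeWeight G W i j * r s(i, j)
  have hsq : √D₀ ≤ √D₁ ^ s * (√D₃ * Real.exp R) ^ t := by
    have h1 : √D₀ ≤ √(D₁ ^ s * D₂ ^ t) := Real.sqrt_le_sqrt hD
    have h2 : √(D₁ ^ s * D₂ ^ t) = √D₁ ^ s * √D₂ ^ t := by
      rw [Real.sqrt_mul (Real.rpow_nonneg hD1 _), Real.sqrt_eq_rpow, Real.sqrt_eq_rpow,
        Real.sqrt_eq_rpow, Real.sqrt_eq_rpow, ← Real.rpow_mul hD1, ← Real.rpow_mul hD2,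
        ← Real.rpow_mul hD1, ← Real.rpow_mul hD2, mul_comm s, mul_comm t]
    have h3 : √D₂ ≤ √D₃ * Real.exp R := by
      refine (Real.sqrt_le_sqrt hR).trans (le_of_eq ?_)
      rw [Real.sqrt_mul hD3, two_mul, Real.exp_add, Real.sqrt_mul_self (Real.exp_pos _).le]
    rw [h2] at h1
    refine h1.trans ?_
    gcongr
  have hexp : Real.exp (-(1 / 2) * E₀) ≤
      Real.exp (-(1 / 2) * E₁) ^ s * (Real.exp (1 / 2 * Q) * Real.exp (-(1 / 2) * E₂)) ^ t := by
    rw [← Real.exp_add, ← Real.exp_mul, ← Real.exp_mul, ← Real.exp_add]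
    refine Real.exp_le_exp.2 ?_
    linarith
  have hCC : C = C ^ s * C ^ t := by rw [← Real.rpow_add hC, hst, Real.rpow_one]
  calc C * Real.exp (-(1 / 2) * E₀) * √D₀
      ≤ (C ^ s * C ^ t) * (Real.exp (-(1 / 2) * E₁) ^ s *
        (Real.exp (1 / 2 * Q) * Real.exp (-(1 / 2) * E₂)) ^ t) *
          (√D₁ ^ s * (√D₃ * Real.exp R) ^ t) := by
        rw [← hCC]; gcongr
    _ = _ := by
        rw [Real.exp_add, Real.mul_rpow (by positivity) (by positivity),
          Real.mul_rpow (by positivity) (by positivity),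
          Real.mul_rpow (by positivity) (by positivity),
          Real.mul_rpow (by positivity) (by positivity),
          Real.mul_rpow (by positivity) (by positivity),
          Real.mul_rpow (by positivity) (by positivity),
          Real.mul_rpow (by positivity) (by positivity),
          Real.mul_rpow (by positivity) (by positivity)]
        ring

variable [DecidableEq V]

theorem measurable_ofReal_mixingDensity (G : SimpleGraph V) (W : Sym2 V → ℝ) (i₀ : V) :
    Measurable fun x => ENNReal.ofReal (mixingDensity G W i₀ (extendByZero i₀ x)) :=
  ((continuous_mixingDensity G W i₀).comp (continuous_extendByZero i₀)).measurable.ennreal_ofReal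

open MeasureTheory in
theorem lintegral_mixingField (G : SimpleGraph V) (W : Sym2 V → ℝ) (i₀ : V)
    {f : (V → ℝ) → ENNReal} (hf : Measurable f) :
    ∫⁻ u, f u ∂(mixingField G W i₀) = ∫⁻ x, f (extendByZero i₀ x) *
      ENNReal.ofReal (mixingDensity G W i₀ (extendByZero i₀ x)) := by
  have hm := (continuous_extendByZero i₀).measurable
  rw [mixingField, lintegral_map hf hm,
    lintegral_withDensity_eq_lintegral_mul _ (measurable_ofReal_mixingDensity G W i₀)
      (g := fun x => f (extendByZero i₀ x)) (hf.comp hm)]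
  simp only [Pi.mul_apply, mul_comm]

open MeasureTheory in
-- Since `v` vanishes at the root, both deformations are translations of the free coordinates and
-- preserve Lebesgue measure. After Hölder, the first factor is controlled by `E e^{u_y} ≤ 1` and
-- the second by the mass for the reduced conductances.
theorem lintegral_exp_mul_le {G : SimpleGraph V} {W : Sym2 V → ℝ}
    (hW : ∀ e ∈ G.edgeSet, 0 < W e) (i₀ : V) {s t : ℝ} (hs : 0 < s) (ht : 0 < t)
    (hst : s + t = 1) {v : V → ℝ} (hv : v i₀ = 0) {r : Sym2 V → ℝ} (hr0 : ∀ e, 0 ≤ r e)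
    (hr1 : ∀ e ∈ G.edgeSet, r e ≤ 1 / 2)
    (hf : ∀ i j, G.Adj i j → 1 - r s(i, j) ≤
      1 / t * Real.exp (s / t * (v j - v i)) - s / t * Real.exp ((v j - v i) / t))
    (y : V) :
    ∫⁻ u, ENNReal.ofReal (Real.exp (s * u y)) ∂(mixingField G W i₀) ≤
      ENNReal.ofReal (Real.exp (-(s * v y) + t * deformationCost G W r)) := by
  have hW' : ∀ e ∈ G.edgeSet, 0 < W e * (1 - r e) := fun e he =>
    mul_pos (hW e he) (by linarith [hr1 e he])
  set v' : {i : V // i ≠ i₀} → ℝ := fun i => v i with hv'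
  have hadd : ∀ (x : {i : V // i ≠ i₀} → ℝ) (c : ℝ) (i : V),
      extendByZero i₀ (x + c • v') i = extendByZero i₀ x i + c * v i := by
    intro x c i
    by_cases h : i = i₀
    · subst h; simp [hv]
    · simp [extendByZero, h, hv']
  set F : ({i : V // i ≠ i₀} → ℝ) → ENNReal := fun x =>
    ENNReal.ofReal (Real.exp (extendByZero i₀ x y)) *
      ENNReal.ofReal (mixingDensity G W i₀ (extendByZero i₀ x)) with hF
  set F' : ({i : V // i ≠ i₀} → ℝ) → ENNReal := fun x =>
    ENNReal.ofReal (mixingDensity G (fun e => W e * (1 - r e)) i₀ (extendByZero i₀ x)) with hF'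
  have hmexp : Measurable fun x : {i : V // i ≠ i₀} → ℝ =>
      ENNReal.ofReal (Real.exp (extendByZero i₀ x y)) :=
    (Real.measurable_exp.comp
      ((continuous_apply y).comp (continuous_extendByZero i₀)).measurable).ennreal_ofReal
  have hFm : Measurable F := hmexp.mul (measurable_ofReal_mixingDensity G W i₀)
  have hFm' : Measurable F' := measurable_ofReal_mixingDensity G _ i₀
  rw [lintegral_mixingField G W i₀ (by fun_prop)]
  -- The exponential is put entirely in the first factor: `e^{s u_y} = (e^{-v_y} e^{u_y + v_y})^s`.
  have hpt : ∀ x : {i : V // i ≠ i₀} → ℝ,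
      ENNReal.ofReal (Real.exp (s * extendByZero i₀ x y)) *
        ENNReal.ofReal (mixingDensity G W i₀ (extendByZero i₀ x)) ≤
      (ENNReal.ofReal (Real.exp (-v y)) * F (x + (1 : ℝ) • v')) ^ s *
        (ENNReal.ofReal (Real.exp (deformationCost G W r)) * F' (x + (-(s / t)) • v')) ^ t := by
    intro x
    have h := mixingDensity_deformation_le hW i₀ hs ht hst v hr0 hr1 hf (extendByZero i₀ x)
    have e1 : extendByZero i₀ (x + (1 : ℝ) • v') = fun i => extendByZero i₀ x i + v i := by
      funext i; rw [hadd, one_mul]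
    have e2 : extendByZero i₀ (x + (-(s / t)) • v') =
        fun i => extendByZero i₀ x i - s / t * v i := by
      funext i; rw [hadd]; ring
    simp only [hF, hF', e1, e2]
    have n1 := mixingDensity_nonneg G W i₀ fun i => extendByZero i₀ x i + v i
    have n2 := mixingDensity_nonneg G (fun e => W e * (1 - r e)) i₀
      fun i => extendByZero i₀ x i - s / t * v i
    rw [← ENNReal.ofReal_mul (Real.exp_pos _).le, ← ENNReal.ofReal_mul (Real.exp_pos _).le,
      ← ENNReal.ofReal_mul (Real.exp_pos _).le, ← ENNReal.ofReal_mul (Real.exp_pos _).le,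
      ENNReal.ofReal_rpow_of_nonneg (by positivity) hs.le,
      ENNReal.ofReal_rpow_of_nonneg (by positivity) ht.le, ← ENNReal.ofReal_mul (by positivity)]
    refine ENNReal.ofReal_le_ofReal ?_
    rw [← mul_assoc, ← Real.exp_add, neg_add_cancel_comm_assoc,
      Real.mul_rpow (Real.exp_pos _).le n1, ← Real.exp_mul, mul_comm (extendByZero i₀ x y) s,
      mul_assoc]
    exact mul_le_mul_of_nonneg_left h (Real.exp_pos _).le
  refine (lintegral_mono hpt).trans ?_
  have hFa : Measurable fun x => F (x + (1 : ℝ) • v') := hFm.comp (measurable_id.add_const _)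
  have hFa' : Measurable fun x => F' (x + (-(s / t)) • v') :=
    hFm'.comp (measurable_id.add_const _)
  refine (ENNReal.lintegral_mul_norm_pow_le (hFa.const_mul _).aemeasurable
    (hFa'.const_mul _).aemeasurable hs.le ht.le hst).trans ?_
  rw [lintegral_const_mul' _ _ ENNReal.ofReal_ne_top, lintegral_const_mul' _ _ ENNReal.ofReal_ne_top,
    lintegral_add_right_eq_self F, lintegral_add_right_eq_self F']
  have h1 : ∫⁻ x, F x ≤ 1 := lintegral_exp_mul_mixingDensity_le_one hW i₀ y
  have h2 : ∫⁻ x, F' x ≤ 1 := lintegral_mixingDensity_le_one hW' i₀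
  calc _ ≤ (ENNReal.ofReal (Real.exp (-v y)) * 1) ^ s *
        (ENNReal.ofReal (Real.exp (deformationCost G W r)) * 1) ^ t := by gcongr
    _ = _ := by
        rw [mul_one, mul_one, ENNReal.ofReal_rpow_of_nonneg (Real.exp_pos _).le hs.le,
          ENNReal.ofReal_rpow_of_nonneg (Real.exp_pos _).le ht.le, ← Real.exp_mul, ← Real.exp_mul,
          ← ENNReal.ofReal_mul (Real.exp_pos _).le, ← Real.exp_add]
        congr 2; ring

end Deformation

/-! ### The wired boxes -/

/-- The sup norm on `ℤ²`. -/
def level (x : ℤ × ℤ) : ℕ := max x.1.natAbs x.2.natAbs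

/-- The profile `∑_{j < min k R} 1 / (2 j + 1)`. -/
noncomputable def profile (R k : ℕ) : ℝ := ∑ j ∈ Finset.range (min k R), 1 / (2 * (j : ℝ) + 1)

theorem profile_zero (R : ℕ) : profile R 0 = 0 := by simp [profile]

theorem profile_of_le {R k : ℕ} (h : R ≤ k) : profile R k = profile R R := by
  simp [profile, h]

theorem profile_succ_sub (R k : ℕ) :
    profile R (k + 1) - profile R k = if k < R then 1 / (2 * (k : ℝ) + 1) else 0 := by
  unfold profile
  split_ifs with h
  · rw [min_eq_left (by omega : k + 1 ≤ R), min_eq_left h.le, Finset.sum_range_succ]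
    ring
  · rw [min_eq_right (by omega), min_eq_right (by omega), sub_self]

theorem abs_profile_sub_le (R k l : ℕ) (h1 : k ≤ l + 1) (h2 : l ≤ k + 1) :
    |profile R k - profile R l| ≤ 1 := by
  have key : ∀ m, |profile R (m + 1) - profile R m| ≤ 1 := by
    intro m
    rw [profile_succ_sub]
    split_ifs
    · rw [abs_of_pos (by positivity), div_le_one (by positivity)]
      have : (0 : ℝ) ≤ m := m.cast_nonneg
      linarith
    · simp
  rcases (by omega : k = l ∨ k = l + 1 ∨ l = k + 1) with rfl | rfl | rfl
  · simp
  · exact key l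
  · rw [abs_sub_comm]; exact key k

/-- Telescoping, from `log ((2n+3)/(2n+1)) ≤ 2/(2n+1)`. -/
theorem half_log_le_profile (R : ℕ) : Real.log (2 * R + 1) / 2 ≤ profile R R := by
  unfold profile
  rw [min_self]
  induction R with
  | zero => simp
  | succ n ih =>
    rw [Finset.sum_range_succ]
    have h0 : (0 : ℝ) < 2 * n + 1 := by positivity
    have h := Real.log_le_sub_one_of_pos (x := (2 * (n : ℝ) + 3) / (2 * n + 1)) (by positivity)
    rw [Real.log_div (by positivity) (by positivity)] at h
    have e : (2 * (n : ℝ) + 3) / (2 * n + 1) - 1 = 2 * (1 / (2 * n + 1)) := by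
      field_simp; ring
    rw [e] at h
    have e2 : 2 * ((n + 1 : ℕ) : ℝ) + 1 = 2 * n + 3 := by push_cast; ring
    rw [e2]
    linarith

theorem sum_natAbs_le_indicator (S : Finset ℤ) (k : ℕ) {c : ℝ} (hc : 0 ≤ c) :
    ∑ b ∈ S, (if b.natAbs ≤ k then c else 0) ≤ (2 * k + 1) * c := by
  rw [← Finset.sum_filter, Finset.sum_const, nsmul_eq_mul]
  refine mul_le_mul_of_nonneg_right ?_ hc
  have h : (S.filter fun b => b.natAbs ≤ k) ⊆ Finset.Icc (-(k : ℤ)) k := by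
    intro b hb
    have := (Finset.mem_filter.1 hb).2
    rw [Finset.mem_Icc]; omega
  have h2 := Finset.card_le_card h
  rw [Int.card_Icc] at h2
  have h3 : ((S.filter fun b => b.natAbs ≤ k).card : ℝ) ≤ ((2 * k + 1 : ℕ) : ℝ) := by
    exact_mod_cast h2.trans (by omega)
  refine h3.trans (le_of_eq ?_)
  push_cast; ring

/-- The step `a → a + σ` changes the sup norm only if `|b|` does not exceed `k = min |a| |a + σ|`,
and then between `k` and `k + 1`. Beyond `R` the profile is constant. -/
theorem sq_profile_sub_le (R : ℕ) {σ : ℤ} (hσ : σ = 1 ∨ σ = -1) (a b : ℤ) :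
    (profile R (max (a + σ).natAbs b.natAbs) - profile R (max a.natAbs b.natAbs)) ^ 2 ≤
      if b.natAbs ≤ min a.natAbs (a + σ).natAbs then
        (if min a.natAbs (a + σ).natAbs < R then
          1 / (2 * ((min a.natAbs (a + σ).natAbs : ℕ) : ℝ) + 1) else 0) ^ 2 else 0 := by
  set k := min a.natAbs (a + σ).natAbs with hk
  split_ifs with h1 h2
  · have := profile_succ_sub R k
    rw [if_pos h2] at this
    rw [← this]
    rcases (by omega : (max (a + σ).natAbs b.natAbs = k + 1 ∧ max a.natAbs b.natAbs = k) ∨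
      (max (a + σ).natAbs b.natAbs = k ∧ max a.natAbs b.natAbs = k + 1)) with ⟨e1, e2⟩ | ⟨e1, e2⟩
    · rw [e1, e2]
    · rw [e1, e2]; apply le_of_eq; ring
  · rw [profile_of_le (by omega), profile_of_le (by omega : R ≤ max a.natAbs b.natAbs)]; simp
  · rw [(by omega : max (a + σ).natAbs b.natAbs = max a.natAbs b.natAbs)]; simp

theorem sum_min_natAbs_le (S : Finset ℤ) (R : ℕ) {σ : ℤ} (hσ : σ = 1 ∨ σ = -1) {φ : ℕ → ℝ}
    (hφ : ∀ k, 0 ≤ φ k) (hφR : ∀ k, ¬ k < R → φ k = 0) :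
    ∑ a ∈ S, φ (min a.natAbs (a + σ).natAbs) ≤ 2 * ∑ k ∈ Finset.range R, φ k := by
  have h1 : ∑ a ∈ S, φ (min a.natAbs (a + σ).natAbs) =
      ∑ a ∈ S with min a.natAbs (a + σ).natAbs < R, φ (min a.natAbs (a + σ).natAbs) := by
    refine (Finset.sum_filter_of_ne fun a _ ha => ?_).symm
    by_contra h
    exact ha (hφR _ h)
  rw [h1, ← Finset.sum_fiberwise_of_maps_to (t := Finset.range R)
    (g := fun a : ℤ => min a.natAbs (a + σ).natAbs)
    (fun a ha => Finset.mem_range.2 (Finset.mem_filter.1 ha).2), Finset.mul_sum]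
  refine Finset.sum_le_sum fun k _ => ?_
  set T := (S.filter fun a : ℤ => min a.natAbs (a + σ).natAbs < R).filter
    fun a : ℤ => min a.natAbs (a + σ).natAbs = k with hT
  have h2 : ∑ a ∈ T, φ (min a.natAbs (a + σ).natAbs) = ∑ _a ∈ T, φ k :=
    Finset.sum_congr rfl fun a ha => by rw [(Finset.mem_filter.1 ha).2]
  rw [h2, Finset.sum_const, nsmul_eq_mul]
  refine mul_le_mul_of_nonneg_right ?_ (hφ k)
  -- The two positions where the step joins levels `k` and `k + 1`: outward from `σ k`, and inward
  -- from `-σ (k + 1)`.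
  have h3 : T ⊆ {σ * k, -σ * (k + 1)} := by
    intro a ha
    have := (Finset.mem_filter.1 ha).2
    simp only [Finset.mem_insert, Finset.mem_singleton]
    rcases hσ with rfl | rfl <;> omega
  have h4 := (Finset.card_le_card h3).trans Finset.card_le_two
  exact_mod_cast h4

/-- For each of the two admissible `a`, at most `2k + 1` values of `b` contribute. The increment `φ
= 1/(2k+1)` satisfies `(2k+1) φ² = φ`, so energy and height are the same sum. The four directions
together give the factor `8` of `dirichlet_energy_le`. -/
theorem sum_sq_profile_sub_le (S : Finset ℤ) (R : ℕ) {σ : ℤ} (hσ : σ = 1 ∨ σ = -1) :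
    ∑ a ∈ S, ∑ b ∈ S,
      (profile R (max (a + σ).natAbs b.natAbs) - profile R (max a.natAbs b.natAbs)) ^ 2 ≤
      2 * profile R R := by
  set φ : ℕ → ℝ := fun k => if k < R then 1 / (2 * (k : ℝ) + 1) else 0 with hφ
  have hφ0 : ∀ k, 0 ≤ φ k := fun k => by
    simp only [hφ]; split_ifs <;> positivity
  have hφ2 : ∀ k : ℕ, (2 * (k : ℝ) + 1) * φ k ^ 2 = φ k := fun k => by
    simp only [hφ]; split_ifs
    · field_simp
    · simp
  calc _ ≤ ∑ a ∈ S, φ (min a.natAbs (a + σ).natAbs) := by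
        refine Finset.sum_le_sum fun a _ => ?_
        refine (Finset.sum_le_sum fun b _ => sq_profile_sub_le R hσ a b).trans ?_
        refine (sum_natAbs_le_indicator S _ (sq_nonneg _)).trans (le_of_eq ?_)
        exact hφ2 _
    _ ≤ 2 * ∑ k ∈ Finset.range R, φ k :=
        sum_min_natAbs_le S R hσ hφ0 fun k hk => if_neg hk
    _ = _ := by
        rw [profile, min_self]
        congr 1
        exact Finset.sum_congr rfl fun k hk => if_pos (Finset.mem_range.1 hk)

theorem lattice_adj_iff (x x' : ℤ × ℤ) : lattice.Adj x x' ↔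
    x' = (x.1 + 1, x.2) ∨ x' = (x.1 + -1, x.2) ∨ x' = (x.1, x.2 + 1) ∨ x' = (x.1, x.2 + -1) := by
  obtain ⟨a, b⟩ := x
  obtain ⟨c, d⟩ := x'
  simp only [lattice, l1Norm, Prod.mk.injEq, Prod.fst_sub, Prod.snd_sub, Int.abs_eq_natAbs]
  omega

open Classical in
theorem sum_lattice_adj_le (S : Finset (ℤ × ℤ)) (x : ℤ × ℤ) {f : ℤ × ℤ → ℝ} (hf : ∀ x, 0 ≤ f x) :
    ∑ x' ∈ S, (if lattice.Adj x x' then f x' else 0) ≤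
      f (x.1 + 1, x.2) + f (x.1 + -1, x.2) + f (x.1, x.2 + 1) + f (x.1, x.2 + -1) := by
  rw [← Finset.sum_filter]
  have h : S.filter (lattice.Adj x) ⊆
      {(x.1 + 1, x.2), (x.1 + -1, x.2), (x.1, x.2 + 1), (x.1, x.2 + -1)} := by
    intro x' hx'
    have := (lattice_adj_iff x x').1 (Finset.mem_filter.1 hx').2
    simpa using this
  refine (Finset.sum_le_sum_of_subset_of_nonneg h fun _ _ _ => hf _).trans (le_of_eq ?_)
  rw [Finset.sum_insert, Finset.sum_insert, Finset.sum_insert, Finset.sum_singleton]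
  · ring
  all_goals simp

open Classical in
theorem dirichlet_energy_le (N R : ℕ) :
    ∑ x ∈ box N, ∑ x' ∈ box N,
      (if lattice.Adj x x' then (profile R (level x') - profile R (level x)) ^ 2 else 0) ≤
      8 * profile R R := by
  refine (Finset.sum_le_sum fun x _ => sum_lattice_adj_le (box N) x
    (f := fun x' => (profile R (level x') - profile R (level x)) ^ 2)
    fun _ => sq_nonneg _).trans ?_
  simp only [Finset.sum_add_distrib, box, Finset.sum_product, level]
  have h1 := sum_sq_profile_sub_le (Finset.Icc (-(N : ℤ)) N) R (σ := 1) (Or.inl rfl)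
  have h2 := sum_sq_profile_sub_le (Finset.Icc (-(N : ℤ)) N) R (σ := -1) (Or.inr rfl)
  have hswap : ∀ σ : ℤ, ∑ a ∈ Finset.Icc (-(N : ℤ)) N, ∑ b ∈ Finset.Icc (-(N : ℤ)) N,
      (profile R (max a.natAbs (b + σ).natAbs) - profile R (max a.natAbs b.natAbs)) ^ 2 =
      ∑ a ∈ Finset.Icc (-(N : ℤ)) N, ∑ b ∈ Finset.Icc (-(N : ℤ)) N,
      (profile R (max (a + σ).natAbs b.natAbs) - profile R (max a.natAbs b.natAbs)) ^ 2 := by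
    intro σ
    rw [Finset.sum_comm]
    refine Finset.sum_congr rfl fun a _ => Finset.sum_congr rfl fun b _ => ?_
    rw [max_comm, max_comm b.natAbs]
  rw [hswap 1, hswap (-1)]
  linarith

/-! ### The wired graph -/

theorem level_le_of_mem_box {N : ℕ} {x : ℤ × ℤ} (h : x ∈ box N) : level x ≤ N := by
  simp only [box, Finset.mem_product, Finset.mem_Icc] at h
  unfold level; omega

theorem lt_level_of_notMem_box {N : ℕ} {x : ℤ × ℤ} (h : x ∉ box N) : N < level x := by
  simp only [box, Finset.mem_product, Finset.mem_Icc] at h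
  unfold level; omega

theorem level_le_succ_of_adj {x x' : ℤ × ℤ} (h : lattice.Adj x x') : level x ≤ level x' + 1 := by
  obtain ⟨a, b⟩ := x
  obtain ⟨c, d⟩ := x'
  simp only [lattice_adj_iff, Prod.mk.injEq] at h
  simp only [level]; omega

theorem contract_of_mem {N : ℕ} {x : ℤ × ℤ} (h : x ∈ box N) : contract N x = some ⟨x, h⟩ :=
  dif_pos h

theorem contract_of_notMem {N : ℕ} {x : ℤ × ℤ} (h : x ∉ box N) : contract N x = none :=
  dif_neg h

theorem contract_eq_some_iff {N : ℕ} {p : ℤ × ℤ} {x : {x : ℤ × ℤ // x ∈ box N}} :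
    contract N p = some x ↔ p = x := by
  constructor
  · intro h
    by_cases hp : p ∈ box N
    · rw [contract_of_mem hp] at h
      exact congrArg Subtype.val (Option.some.inj h)
    · rw [contract_of_notMem hp] at h
      cases h
  · rintro rfl
    exact contract_of_mem x.2

theorem exists_lattice_edge {N : ℕ} {i j : WiredVertex N} {f : Sym2 (ℤ × ℤ)}
    (hf : f ∈ lattice.edgeSet) (h : f.map (contract N) = s(i, j)) :
    ∃ p q, lattice.Adj p q ∧ contract N p = i ∧ contract N q = j ∧ f = s(p, q) := by
  induction f using Sym2.ind with
  | _ p q =>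
    rw [Sym2.map_mk, Sym2.eq_iff] at h
    rcases h with ⟨h1, h2⟩ | ⟨h1, h2⟩
    · exact ⟨p, q, hf, h1, h2, rfl⟩
    · exact ⟨q, p, SimpleGraph.Adj.symm (G := lattice) hf, h2, h1, Sym2.eq_swap⟩

theorem wiredConductance_pos {N : ℕ} {W : Sym2 (ℤ × ℤ) → ℝ}
    (hW : ∀ e ∈ lattice.edgeSet, 0 < W e) (e : Sym2 (WiredVertex N))
    (he : e ∈ (wiredGraph N).edgeSet) : 0 < wiredConductance N W e := by
  induction e using Sym2.ind with
  | _ i j =>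
    obtain ⟨hij, f, hf, hfe⟩ := he
    -- Finiteness matters because a `finsum` with infinite support would be zero by convention. As
    -- `i ≠ j`, some endpoint lies in the box, so both lie in the box enlarged by one.
    have hfin : {f : Sym2 (ℤ × ℤ) | f ∈ lattice.edgeSet ∧ f.map (contract N) = s(i, j)}.Finite := by
      refine ((box (N + 1) ×ˢ box (N + 1)).image fun p => s(p.1, p.2)).finite_toSet.subset ?_
      rintro f ⟨hf, hfe⟩
      obtain ⟨p, q, hpq, hp, hq, rfl⟩ := exists_lattice_edge hf hfe
      have hbox : ∀ x : ℤ × ℤ, level x ≤ N + 1 → x ∈ box (N + 1) := fun x hx => by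
        by_contra h
        have := lt_level_of_notMem_box h
        omega
      have hle : level p ≤ N + 1 ∧ level q ≤ N + 1 := by
        have h1 := level_le_succ_of_adj hpq
        have h2 := level_le_succ_of_adj hpq.symm
        by_cases hpb : p ∈ box N
        · have := level_le_of_mem_box hpb; omega
        · by_cases hqb : q ∈ box N
          · have := level_le_of_mem_box hqb; omega
          · rw [contract_of_notMem hpb] at hp
            rw [contract_of_notMem hqb] at hq
            exact absurd (hp.symm.trans hq) hij
      simp only [Finset.coe_image, Set.mem_image, Finset.mem_coe, Finset.mem_product]
      exact ⟨(p, q), ⟨hbox _ hle.1, hbox _ hle.2⟩, rfl⟩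
    rw [wiredConductance, finsum_mem_eq_finite_toFinset_sum _ hfin]
    refine Finset.sum_pos (fun f hf => hW f ?_) ⟨f, ?_⟩
    · exact ((Set.Finite.mem_toFinset _).1 hf).1
    · exact (Set.Finite.mem_toFinset _).2 ⟨hf, hfe⟩

theorem wiredGraph_adj_some {N : ℕ} {x x' : {x : ℤ × ℤ // x ∈ box N}}
    (h : (wiredGraph N).Adj (some x) (some x')) : lattice.Adj x x' := by
  obtain ⟨-, f, hf, hfe⟩ := h
  obtain ⟨p, q, hpq, hp, hq, rfl⟩ := exists_lattice_edge hf hfe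
  rw [contract_eq_some_iff] at hp hq
  rwa [← hp, ← hq]

theorem wiredConductance_some {N : ℕ} (W : Sym2 (ℤ × ℤ) → ℝ)
    {x x' : {x : ℤ × ℤ // x ∈ box N}} (h : (wiredGraph N).Adj (some x) (some x')) :
    wiredConductance N W s(some x, some x') = W s((x : ℤ × ℤ), (x' : ℤ × ℤ)) := by
  have hS : {f : Sym2 (ℤ × ℤ) | f ∈ lattice.edgeSet ∧ f.map (contract N) = s(some x, some x')} =
      {s((x : ℤ × ℤ), (x' : ℤ × ℤ))} := by
    ext f
    constructor
    · rintro ⟨hf, hfe⟩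
      obtain ⟨p, q, hpq, hp, hq, rfl⟩ := exists_lattice_edge hf hfe
      rw [contract_eq_some_iff] at hp hq
      rw [hp, hq]; rfl
    · rintro rfl
      refine ⟨wiredGraph_adj_some h, ?_⟩
      rw [Sym2.map_mk, contract_of_mem x.2, contract_of_mem x'.2]
  rw [wiredConductance, hS, finsum_mem_singleton]

/-- The radial deformation of height `κ * profile R R`. -/
noncomputable def radialField (N R : ℕ) (κ : ℝ) : WiredVertex N → ℝ
  | none => κ * profile R R
  | some x => κ * profile R (level x)

theorem radialField_contract {N R : ℕ} (hR : R ≤ N) (κ : ℝ) (x : ℤ × ℤ) :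
    radialField N R κ (contract N x) = κ * profile R (level x) := by
  by_cases h : x ∈ box N
  · rw [contract_of_mem h]; rfl
  · rw [contract_of_notMem h, profile_of_le (hR.trans (lt_level_of_notMem_box h).le)]; rfl

theorem exists_adj_of_wiredGraph_adj {N : ℕ} {i j : WiredVertex N} (h : (wiredGraph N).Adj i j) :
    ∃ p q, lattice.Adj p q ∧ contract N p = i ∧ contract N q = j := by
  obtain ⟨-, f, hf, hfe⟩ := h
  obtain ⟨p, q, hpq, hp, hq, -⟩ := exists_lattice_edge hf hfe
  exact ⟨p, q, hpq, hp, hq⟩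

theorem abs_radialField_sub_le {N R : ℕ} (hR : R ≤ N) {κ : ℝ} (hκ : 0 ≤ κ) {i j : WiredVertex N}
    (h : (wiredGraph N).Adj i j) : |radialField N R κ j - radialField N R κ i| ≤ κ := by
  obtain ⟨p, q, hpq, rfl, rfl⟩ := exists_adj_of_wiredGraph_adj h
  rw [radialField_contract hR, radialField_contract hR, ← mul_sub, abs_mul, abs_of_nonneg hκ]
  exact mul_le_of_le_one_right hκ
    (abs_profile_sub_le _ _ _ (level_le_succ_of_adj hpq.symm) (level_le_succ_of_adj hpq))

/-- A neighbour of `δ_N` has level at least `N ≥ R`, where the profile is saturated. Edges to `δ_N`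
therefore cost nothing, although their conductances are sums that may exceed the uniform bound. -/
theorem radialField_eq_of_adj_none {N R : ℕ} (hR : R ≤ N) (κ : ℝ) {i : WiredVertex N}
    (h : (wiredGraph N).Adj none i) : radialField N R κ i = radialField N R κ none := by
  obtain ⟨p, q, hpq, hp, rfl⟩ := exists_adj_of_wiredGraph_adj h
  have hpb : p ∉ box N := fun hpb => by
    rw [contract_of_mem hpb] at hp
    cases hp
  have h1 := lt_level_of_notMem_box hpb
  have h2 := level_le_succ_of_adj hpq
  rw [radialField_contract hR, profile_of_le (by omega)]
  rfl

/-- The relative reduction of the conductances, quadratic in the gradient of the field `v`. -/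
noncomputable def quadraticReduction {V : Type*} (B : ℝ) (v : V → ℝ) : Sym2 V → ℝ :=
  Sym2.lift ⟨fun i j => B * (v j - v i) ^ 2, fun i j => by ring⟩

theorem quadraticReduction_mk {V : Type*} (B : ℝ) (v : V → ℝ) (i j : V) :
    quadraticReduction B v s(i, j) = B * (v j - v i) ^ 2 := rfl

theorem deformationCost_wired_le {N R : ℕ} (hR : R ≤ N) {W : Sym2 (ℤ × ℤ) → ℝ} {Wbar : ℝ}
    (hWbar : 0 < Wbar) (hW : ∀ e ∈ lattice.edgeSet, W e ≤ Wbar) {B κ : ℝ} (hB : 0 ≤ B) :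
    deformationCost (wiredGraph N) (wiredConductance N W)
      (quadraticReduction B (radialField N R κ)) ≤
      (Wbar / 2 + 1) * B * κ ^ 2 * (8 * profile R R) := by
  classical
  rw [deformationCost, Fintype.sum_option]
  have h0 : ∀ i j : WiredVertex N, (i = none ∨ j = none) →
      (if (wiredGraph N).Adj i j then (wiredConductance N W s(i, j) / 2 + 1) *
        quadraticReduction B (radialField N R κ) s(i, j) else 0) = 0 := by
    intro i j hij
    split_ifs with h
    · have : radialField N R κ j = radialField N R κ i := by
        rcases hij with rfl | rfl
        · exact radialField_eq_of_adj_none hR κ h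
        · exact (radialField_eq_of_adj_none hR κ h.symm).symm
      rw [quadraticReduction_mk, this]; simp
    · rfl
  rw [Finset.sum_eq_zero fun j _ => h0 none j (Or.inl rfl), zero_add]
  have h1 : ∀ x x' : {x : ℤ × ℤ // x ∈ box N},
      (if (wiredGraph N).Adj (some x) (some x') then
        (wiredConductance N W s(some x, some x') / 2 + 1) *
        quadraticReduction B (radialField N R κ) s(some x, some x') else 0) ≤
      (Wbar / 2 + 1) * B * κ ^ 2 * (if lattice.Adj x x' then
        (profile R (level x') - profile R (level x)) ^ 2 else 0) := by
    intro x x'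
    split_ifs with h h' h'
    · rw [wiredConductance_some W h, quadraticReduction_mk]
      have hw := hW _ (show s((x : ℤ × ℤ), (x' : ℤ × ℤ)) ∈ lattice.edgeSet from h')
      have e : B * (radialField N R κ (some x') - radialField N R κ (some x)) ^ 2 =
          B * κ ^ 2 * (profile R (level x') - profile R (level x)) ^ 2 := by
        simp only [radialField]; ring
      rw [e, mul_assoc (Wbar / 2 + 1), mul_assoc (Wbar / 2 + 1)]
      gcongr
    · exact absurd (wiredGraph_adj_some h) h'
    · positivity
    · simp
  calc _ ≤ ∑ x : {x : ℤ × ℤ // x ∈ box N}, ∑ x' : {x : ℤ × ℤ // x ∈ box N},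
        (Wbar / 2 + 1) * B * κ ^ 2 * (if lattice.Adj x x' then
          (profile R (level x') - profile R (level x)) ^ 2 else 0) := by
        refine Finset.sum_le_sum fun x _ => ?_
        rw [Fintype.sum_option, h0 _ _ (Or.inr rfl), zero_add]
        exact Finset.sum_le_sum fun x' _ => h1 x x'
    _ = (Wbar / 2 + 1) * B * κ ^ 2 * ∑ x ∈ box N, ∑ x' ∈ box N, (if lattice.Adj x x' then
          (profile R (level x') - profile R (level x)) ^ 2 else 0) := by
        simp only [← Finset.mul_sum]
        congr 1
        rw [← Finset.sum_coe_sort (box N)]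
        refine Finset.sum_congr rfl fun x _ => ?_
        exact Finset.sum_coe_sort (box N) fun x' => if lattice.Adj x x' then
          (profile R (level x') - profile R (level x)) ^ 2 else 0
    _ ≤ _ := by
        refine mul_le_mul_of_nonneg_left ?_ (by positivity)
        convert dirichlet_energy_le N R

/-! ### Polynomial decay -/

/-- The right side is `e^{pz} (p + 1 - p e^z)`, whose first-order terms cancel. The bounds `e^{pz} ≥
1 + pz` and `e^z ≤ 1 + z + z²` give `1 - p z² (p + 1 + pz)`, and `pz ≤ p + 1`. In the application `p
+ 1 = q` and `p = s/t`. -/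
theorem one_sub_sq_le_exp_comb {p z : ℝ} (hp : 0 < p) (hz : |(p + 1) * z| ≤ 1 / 2) :
    1 - 2 * ((p + 1) * p) * z ^ 2 ≤
      (p + 1) * Real.exp (p * z) - p * Real.exp ((p + 1) * z) := by
  have hz' : (p + 1) * |z| ≤ 1 / 2 := by rwa [abs_mul, abs_of_pos (by linarith)] at hz
  have hz1 : |z| ≤ 1 / 2 := by nlinarith [abs_nonneg z]
  have hpz : |p * z| ≤ 1 / 2 := by
    rw [abs_mul, abs_of_pos hp]; nlinarith [abs_nonneg z]
  have h1 := (abs_le.1 (Real.abs_exp_sub_one_sub_id_le (hz1.trans (by norm_num)))).2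
  have h2 := Real.add_one_le_exp (p * z)
  have hz2 : z ^ 2 ≤ |z| / 2 := by rw [← sq_abs]; nlinarith [abs_nonneg z]
  have h3 : 0 ≤ 1 - p * z - p * z ^ 2 := by
    have := (abs_le.1 hpz).2
    nlinarith [abs_nonneg z, mul_le_mul_of_nonneg_left hz2 hp.le]
  have e : Real.exp ((p + 1) * z) = Real.exp (p * z) * Real.exp z := by
    rw [← Real.exp_add]; congr 1; ring
  rw [e]
  have h4 : 1 - p * z - p * z ^ 2 ≤ (p + 1) - p * Real.exp z := by nlinarith
  have h5 : (p * z + 1) * (1 - p * z - p * z ^ 2) ≤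
      Real.exp (p * z) * ((p + 1) - p * Real.exp z) :=
    mul_le_mul h2 h4 h3 (Real.exp_pos _).le
  have h6 : (p * z + 1) * (1 - p * z - p * z ^ 2) = 1 - p * z ^ 2 * ((p + 1) + p * z) := by ring
  have h7 : p * z ≤ p + 1 := by
    have := (abs_le.1 hpz).2
    linarith
  have h8 : p * z ^ 2 * ((p + 1) + p * z) ≤ p * z ^ 2 * ((p + 1) + (p + 1)) := by gcongr
  nlinarith

theorem l1Norm_le_two_mul_level (y : ℤ × ℤ) : (l1Norm y : ℝ) ≤ 2 * level y + 1 := by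
  have : l1Norm y ≤ 2 * (level y : ℤ) + 1 := by
    simp only [l1Norm, level, Int.abs_eq_natAbs]; omega
  exact_mod_cast this

theorem one_le_l1Norm {y : ℤ × ℤ} (hy : y ≠ 0) : (1 : ℝ) ≤ l1Norm y := by
  have : 1 ≤ l1Norm y := by
    simp only [l1Norm, Int.abs_eq_natAbs]
    by_contra h
    exact hy (Prod.ext (by simp only [Prod.fst_zero]; omega) (by simp only [Prod.snd_zero]; omega))
  exact_mod_cast this

open MeasureTheory in
theorem lintegral_exp_wiredField_le {W : Sym2 (ℤ × ℤ) → ℝ} {Wbar s q : ℝ} (hWbar : 0 < Wbar)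
    (hs : 0 < s) (hs1 : s < 1) (hq : s + 1 / q = 1)
    (hW : ∀ e ∈ lattice.edgeSet, 0 < W e ∧ W e ≤ Wbar) {N : ℕ} {y : ℤ × ℤ} (hy : y ∈ box N)
    (hy0 : y ≠ 0) :
    ∫⁻ u : WiredVertex N → ℝ, ENNReal.ofReal (Real.exp (s * u (contract N y))) ∂(wiredField N W) ≤
      ENNReal.ofReal ((l1Norm y : ℝ) ^ (-(s ^ 2 / (64 * q ^ 2 * (Wbar + 1))))) := by
  have hq1 : 1 / q = 1 - s := by linarith
  have hq0 : 0 < q := by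
    have : 0 < 1 / q := by linarith
    exact one_div_pos.1 this
  have hqs : q * s = q - 1 := by
    have : q * (1 / q) = 1 := mul_one_div_cancel hq0.ne'
    rw [hq1] at this; linarith
  have hp : 0 < q - 1 := by rw [← hqs]; positivity
  -- Truncating at the level of `y` gives `v` its full height at `y` and spends no energy beyond it.
  set R := level y with hR
  have hRN : R ≤ N := level_le_of_mem_box hy
  -- Minimiser of `-s κ h + 16 q s (Wbar + 1) κ² h`, with `h = profile R R`: the cost is half of the
  -- gain, leaving `-s κ h / 2`. It also makes `q` times the gradient at most `1/32`, as the
  -- quadratic estimates require.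
  set κ := 1 / (32 * q * (Wbar + 1)) with hκ
  have hκ0 : 0 < κ := by positivity
  have hqκ : q * κ ≤ 1 / 32 := by
    have : q * κ = 1 / 32 * (1 / (Wbar + 1)) := by rw [hκ]; field_simp
    rw [this]
    have : 1 / (Wbar + 1) ≤ 1 := by rw [div_le_one (by positivity)]; linarith
    linarith
  set v := radialField N R κ with hv
  set B := 2 * (q * (q - 1)) with hB
  have hB0 : 0 ≤ B := by positivity
  have hgrad : ∀ i j, (wiredGraph N).Adj i j → |q * (v j - v i)| ≤ 1 / 32 := by
    intro i j h
    rw [abs_mul, abs_of_pos hq0]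
    exact (mul_le_mul_of_nonneg_left (abs_radialField_sub_le hRN hκ0.le h) hq0.le).trans hqκ
  have key := lintegral_exp_mul_le (G := wiredGraph N) (W := wiredConductance N W)
    (wiredConductance_pos fun e he => (hW e he).1) (contract N 0) hs
    (t := 1 / q) (by positivity) hq (v := v) (r := quadraticReduction B v)
    (by
      rw [hv, radialField_contract hRN]
      simp [level, profile_zero])
    (fun e => by
      induction e using Sym2.ind with
      | _ i j => rw [quadraticReduction_mk]; positivity)
    (fun e he => by
      induction e using Sym2.ind with
      | _ i j =>
        have h1 := hgrad i j he
        have h2 : (q * (v j - v i)) ^ 2 ≤ (1 / 32) ^ 2 := by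
          rw [← sq_abs]; gcongr
        have h3 : q * (q - 1) * (v j - v i) ^ 2 ≤ (q * (v j - v i)) ^ 2 := by
          rw [mul_pow, sq q]; gcongr; linarith
        rw [quadraticReduction_mk, hB, mul_assoc]
        nlinarith)
    (fun i j h => by
      have h1 := one_sub_sq_le_exp_comb hp (z := v j - v i)
        (by rw [sub_add_cancel]; exact (hgrad i j h).trans (by norm_num))
      rw [sub_add_cancel] at h1
      have e1 : s / (1 / q) = q - 1 := by rw [← hqs]; field_simp
      have e2 : (v j - v i) / (1 / q) = q * (v j - v i) := by field_simp
      rw [quadraticReduction_mk, e1, e2, one_div_one_div]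
      exact h1)
    (contract N y)
  refine key.trans (ENNReal.ofReal_le_ofReal ?_)
  have hcost := deformationCost_wired_le hRN hWbar (fun e he => (hW e he).2) (κ := κ) hB0
  rw [← hv] at hcost
  have hprof := half_log_le_profile R
  have hy1 := one_le_l1Norm hy0
  have hlog : Real.log (l1Norm y) / 2 ≤ profile R R := by
    refine le_trans ?_ hprof
    have := Real.log_le_log (by linarith) (l1Norm_le_two_mul_level y)
    linarith
  have hlog0 : 0 ≤ Real.log (l1Norm y) := Real.log_nonneg hy1
  have hh0 : 0 ≤ profile R R := by linarith
  rw [Real.rpow_def_of_pos (by linarith)]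
  refine Real.exp_le_exp.2 ?_
  have hvy : v (contract N y) = κ * profile R R := by
    rw [hv, radialField_contract hRN]
  rw [hvy]
  have h1 : 1 / q * deformationCost (wiredGraph N) (wiredConductance N W)
      (quadraticReduction B v) ≤ s * κ * profile R R / 2 := by
    calc _ ≤ 1 / q * ((Wbar / 2 + 1) * B * κ ^ 2 * (8 * profile R R)) := by gcongr
      _ = (Wbar / 2 + 1) * κ * (16 * (q * s)) * (κ * profile R R) := by
          rw [hB, hqs]; field_simp; ring
      _ ≤ (Wbar + 1) * κ * (16 * (q * s)) * (κ * profile R R) := by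
          gcongr; linarith
      _ = _ := by
          have : (Wbar + 1) * κ * q = 1 / 32 := by rw [hκ]; field_simp
          linear_combination 16 * s * κ * profile R R * this
  have h2 : s * κ * (Real.log (l1Norm y) / 2) ≤ s * κ * profile R R := by gcongr
  -- The deformation yields the exponent `s κ / 4`, since `h ≥ (log |y|₁) / 2`. The stated exponent
  -- is `(s κ / 2) (s / q)`, which is smaller because `s / q = s (1 - s) ≤ 1/4`.
  have h3 : s ^ 2 / (64 * q ^ 2 * (Wbar + 1)) ≤ s * κ / 4 := by
    have e1 : s ^ 2 / (64 * q ^ 2 * (Wbar + 1)) = s * κ / 2 * (s * (1 / q)) := by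
      rw [hκ]; field_simp; ring
    rw [e1, hq1]
    have : s * (1 - s) ≤ 1 / 4 := by nlinarith [sq_nonneg (s - 1 / 2)]
    have h0 : 0 ≤ s * κ / 2 := by positivity
    nlinarith
  have h4 := mul_le_mul_of_nonneg_left h3 hlog0
  nlinarith

open MeasureTheory in
theorem wiredField_moment {W : Sym2 (ℤ × ℤ) → ℝ} {Wbar s q : ℝ} (hWbar : 0 < Wbar)
    (hs : 0 < s) (hs1 : s < 1) (hq : s + 1 / q = 1)
    (hW : ∀ e ∈ lattice.edgeSet, 0 < W e ∧ W e ≤ Wbar) {N : ℕ} {y : ℤ × ℤ} (hy : y ∈ box N)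
    (hy0 : y ≠ 0) :
    Integrable (fun u : WiredVertex N → ℝ => Real.exp (s * u (contract N y))) (wiredField N W) ∧
    ∫ u : WiredVertex N → ℝ, Real.exp (s * u (contract N y)) ∂(wiredField N W) ≤
      (l1Norm y : ℝ) ^ (-(s ^ 2 / (64 * q ^ 2 * (Wbar + 1)))) := by
  have h := lintegral_exp_wiredField_le hWbar hs hs1 hq hW hy hy0
  have hm : AEStronglyMeasurable (fun u : WiredVertex N → ℝ => Real.exp (s * u (contract N y)))
      (wiredField N W) := by
    apply Measurable.aestronglyMeasurable; fun_prop
  have hnn : 0 ≤ᵐ[wiredField N W] fun u : WiredVertex N → ℝ => Real.exp (s * u (contract N y)) :=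
    Filter.Eventually.of_forall fun u => (Real.exp_pos _).le
  constructor
  · refine ⟨hm, ?_⟩
    rw [hasFiniteIntegral_iff_ofReal hnn]
    exact h.trans_lt ENNReal.ofReal_lt_top
  · rw [integral_eq_lintegral_of_nonneg_ae hnn hm]
    refine ENNReal.toReal_le_of_le_ofReal ?_ h
    have := one_le_l1Norm hy0
    positivity

theorem theorem1 :
    ∃ N₀ : ℕ,
      (∃ c₀ : ℝ, 0 < c₀ ∧
        ∀ Wbar s q : ℝ, 0 < Wbar → 0 < s → s < 1 → s + 1 / q = 1 →
          ∃ η : ℝ, 0 < η ∧ η = c₀ * s ^ 2 / (8 * q ^ 2 * (Wbar + 1)) ∧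
            ∀ W : Sym2 (ℤ × ℤ) → ℝ, (∀ e ∈ lattice.edgeSet, 0 < W e ∧ W e ≤ Wbar) →
              ∀ N : ℕ, N₀ ≤ N → ∀ y ∈ box N, y ≠ 0 →
                MeasureTheory.Integrable
                  (fun u : WiredVertex N → ℝ => Real.exp (s * u (contract N y)))
                  (wiredField N W) ∧
                ∫ u : WiredVertex N → ℝ, Real.exp (s * u (contract N y)) ∂(wiredField N W)
                  ≤ (l1Norm y : ℝ) ^ (-η)) ∧
      (∀ c : ℝ, 0 < c → c < 1 / 8 → ∃ r : ℝ,
        ∀ Wbar s q : ℝ, 0 < Wbar → 0 < s → s < 1 → s + 1 / q = 1 →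
          ∀ W : Sym2 (ℤ × ℤ) → ℝ, (∀ e ∈ lattice.edgeSet, 0 < W e ∧ W e ≤ Wbar) →
            ∀ N : ℕ, N₀ ≤ N → ∀ y ∈ box N, y ≠ 0 → r ≤ (l1Norm y : ℝ) →
              ∫ u : WiredVertex N → ℝ, Real.exp (s * u (contract N y)) ∂(wiredField N W)
                ≤ (l1Norm y : ℝ) ^ (-(c * s ^ 2 / (8 * q ^ 2 * (Wbar + 1))))) := by

  -- The constant `1/8` itself is attained for every box and every `y ≠ 0`. Thus `N₀ = 0`, and the
  -- second claim holds with `r = 0`, because lowering the constant weakens the bound when `|y|₁ ≥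
  -- 1`.
  refine ⟨0, ⟨1 / 8, by norm_num, ?_⟩, ?_⟩
  · intro Wbar s q hWbar hs hs1 hq
    have hq0 : 0 < q := one_div_pos.1 (by linarith)
    refine ⟨_, by positivity, rfl, fun W hW N _ y hy hy0 => ?_⟩
    have h := wiredField_moment hWbar hs hs1 hq hW hy hy0
    have e : 1 / 8 * s ^ 2 / (8 * q ^ 2 * (Wbar + 1)) = s ^ 2 / (64 * q ^ 2 * (Wbar + 1)) := by
      field_simp; norm_num
    rw [e]
    exact h
  · intro c hc hc8
    refine ⟨0, fun Wbar s q hWbar hs hs1 hq W hW N _ y hy hy0 _ => ?_⟩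
    have hq0 : 0 < q := one_div_pos.1 (by linarith)
    refine (wiredField_moment hWbar hs hs1 hq hW hy hy0).2.trans ?_
    refine Real.rpow_le_rpow_of_exponent_le (one_le_l1Norm hy0) (neg_le_neg ?_)
    have e : s ^ 2 / (64 * q ^ 2 * (Wbar + 1)) = 1 / 8 * s ^ 2 / (8 * q ^ 2 * (Wbar + 1)) := by
      field_simp; norm_num
    rw [e]
    gcongr
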